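/- **Theorem 1.1.** Let $n\ge 2$ and let $\beta\equiv\beta^{(2n)}=(\beta_{ij})_{i,j\ge 0,\ i+j\le 2n}$ be real numbers with $\beta_{00}>0$. Let $Q\in\mathbb{R}[x,y]$ have degree $2$, with quadratic part $ax^2+bxy+cy^2$ satisfying $b^2-4ac>0$, so that $Q(x,y)=0$ is a hyperbola (possibly degenerate, i.e. a pair of intersecting lines). Let $\mathcal{M}(n)=\mathcal{M}(n)(\beta)$ be the moment matrix: its rows and columns are indexed by the monomials $Y^iX^j$ with $i+j\le n$, and its entry in row $Y^iX^j$ and column $Y^kX^\ell$ is $\beta_{i+k,j+\ell}$. For a real polynomial $p=\sum a_{ij}y^ix^j$ of degree at most $n$, let $p(X,Y)=\sum a_{ij}Y^iX^j$ be the corresponding linear combination of columns of $\mathcal{M}(n)$, and let $\mathcal{Z}(p)=\{(x,y)\in\mathbb{R}^2 : p(x,y)=0\}$. The matrix $\mathcal{M}(n)$ is *recursively generated* if, whenever $p$, $q$ and $pq$ have degree at most $n$ and $p(X,Y)=0$, also $(pq)(X,Y)=0$. The *variety* of $\mathcal{M}(n)$ is $\mathcal{V}(\mathcal{M}(n))=\bigcap\{\mathcal{Z}(p)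 : \deg p\le n,\ p(X,Y)=0\}$. A *$Q$-representing measure* for $\beta$ is a positive Borel measure $\mu$ on $\mathbb{R}^2$ with $\operatorname{supp}\mu\subseteq\mathcal{Z}(Q)$ such that, for all $i,j\ge 0$ with $i+j\le 2n$, the function $y^ix^j$ is $\mu$-integrable and $\beta_{ij}=\int y^ix^j\,d\mu$. Then $\beta$ has a $Q$-representing measure if and only if the following four conditions all hold: $\mathcal{M}(n)$ is positive semidefinite; $\mathcal{M}(n)$ is recursively generated; $Q(X,Y)=0$; and $\operatorname{rank}\mathcal{M}(n)\le\operatorname{card}\mathcal{V}(\mathcal{M}(n))$. In this case $\operatorname{rank}\mathcal{M}(n)\le 2n+1$. If $\operatorname{rank}\mathcal{M}(n)\le 2n$, then there is a $Q$-representing measure that is $\operatorname{rank}\mathcal{M}(n)$-atomic, i.e. a sum of exactly $\operatorname{rank}\mathcal{M}(n)$ positive point masses at distinct points. If $\operatorname{rank}\mathcal{M}(n)=2n+1$, then there is a $Q$-representing measure $\mu$ with $2n+1\le\operatorname{card}\operatorname{supp}\mu\le 2n+2$. -/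

import Mathlib

open MeasureTheory

namespace HypMoment

noncomputable section

/-- Exponent pairs `(i, j)`, standing for the monomial `y ^ i * x ^ j`, with `i + j ≤ n`. -/
def exps (n : ℕ) : Finset (ℕ × ℕ) :=
  (Finset.range (n + 1) ×ˢ Finset.range (n + 1)).filter (fun e => e.1 + e.2 ≤ n)

/-- The index set of the rows and columns `Y ^ i X ^ j` (`i + j ≤ n`) of the moment matrix. -/
abbrev Idx (n : ℕ) : Type := {e : ℕ × ℕ // e ∈ exps n}

/-- The moment matrix `M(n)(β)`: the entry in row `Y ^ i X ^ j` and column `Y ^ k X ^ l` is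
`β (i + k) (j + l)`. Only the values `β i j` with `i + j ≤ 2 n` occur. -/
def momentMatrix (n : ℕ) (β : ℕ → ℕ → ℝ) : Matrix (Idx n) (Idx n) ℝ :=
  Matrix.of fun r c => β (r.1.1 + c.1.1) (r.1.2 + c.1.2)

/-- Real polynomials in two variables; the variable `0` is `x` and the variable `1` is `y`. -/
abbrev Poly : Type := MvPolynomial (Fin 2) ℝ

/-- The coefficient of `y ^ i * x ^ j` in `p`. -/
def coeffYX (p : Poly) (i j : ℕ) : ℝ :=
  MvPolynomial.coeff (Finsupp.single 1 i + Finsupp.single 0 j) p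

/-- The element `p(X, Y) = ∑ a_ij Y ^ i X ^ j` of the column space of `M(n)(β)`,
for a polynomial `p = ∑ a_ij y ^ i x ^ j` of degree at most `n`. -/
def polyCol (n : ℕ) (β : ℕ → ℕ → ℝ) (p : Poly) : Idx n → ℝ :=
  ∑ e : Idx n, coeffYX p e.1.1 e.1.2 • (momentMatrix n β).col e

/-- The real zero set of `p` in the plane, a point being `(x, y)`. -/
def zeroSet (p : Poly) : Set (ℝ × ℝ) :=
  {z | MvPolynomial.eval ![z.1, z.2] p = 0}

/-- `M(n)(β)` is recursively generated. -/
def RecursivelyGenerated (n : ℕ) (β : ℕ → ℕ → ℝ) : Prop :=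
  ∀ p q : Poly, p.totalDegree ≤ n → q.totalDegree ≤ n → (p * q).totalDegree ≤ n →
    polyCol n β p = 0 → polyCol n β (p * q) = 0

/-- The algebraic variety of `M(n)(β)`: the common zeros of all polynomials `p` of degree at
most `n` with `p(X, Y) = 0`. -/
def momentVariety (n : ℕ) (β : ℕ → ℕ → ℝ) : Set (ℝ × ℝ) :=
  ⋂ (p : Poly) (_ : p.totalDegree ≤ n) (_ : polyCol n β p = 0), zeroSet p

/-- `Q(x, y) = 0` is a hyperbola, possibly degenerate (two intersecting lines): `Q` has degree
two and its quadratic part `a x² + b x y + c y²` satisfies `b² - 4 a c > 0`. -/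
def IsHyperbola (Q : Poly) : Prop :=
  Q.totalDegree = 2 ∧ 0 < coeffYX Q 1 1 ^ 2 - 4 * coeffYX Q 0 2 * coeffYX Q 2 0

/-- `μ` is a representing measure for `β` (up to degree `2 n`): all the moments up to degree
`2 n` converge, and `β i j = ∫ y ^ i x ^ j dμ`. -/
def IsRepresenting (n : ℕ) (β : ℕ → ℕ → ℝ) (μ : Measure (ℝ × ℝ)) : Prop :=
  ∀ i j : ℕ, i + j ≤ 2 * n →
    Integrable (fun z : ℝ × ℝ => z.2 ^ i * z.1 ^ j) μ ∧
      β i j = ∫ z : ℝ × ℝ, z.2 ^ i * z.1 ^ j ∂μ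

/-- `μ` is a `Q`-representing measure for `β`: it is representing, and its closed support lies
in the zero set of `Q`. -/
def IsQRepresenting (n : ℕ) (β : ℕ → ℕ → ℝ) (Q : Poly) (μ : Measure (ℝ × ℝ)) : Prop :=
  IsRepresenting n β μ ∧ μ.support ⊆ zeroSet Q

/-- `μ` is `r`-atomic: a sum of `r` point masses, with positive finite weights, at distinct
points. -/
def IsAtomicOfCard (r : ℕ) (μ : Measure (ℝ × ℝ)) : Prop :=
  ∃ (S : Finset (ℝ × ℝ)) (ρ : ℝ × ℝ → ℝ), S.card = r ∧ (∀ z ∈ S, 0 < ρ z) ∧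
    μ = ∑ z ∈ S, ENNReal.ofReal (ρ z) • Measure.dirac z

end

end HypMoment

/-! ### Quadrature in one variable -/

namespace HypMoment

open Polynomial (X C)

/-! Let `L` be the functional `y ^ i * x ^ j ↦ β i j`. The moment matrix is the Gram matrix of `(p,
q) ↦ L (p * q)` in degree at most `n`, so positivity, kernel and rank are statements about `L`.
Necessity is then soft: for a representing measure, `L (p ^ 2) = 0` forces `p` to vanish on the
support. Hence the kernel consists of the polynomials vanishing there, and the rank is at most the
number of support points, all of which lie in the variety.

For sufficiency, affine coordinates turn `Q`, up to a nonzero scalar, into `U V - 1` or `U V`. The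
relation `Q(X, Y) = 0` with recursive generation kills `L` on the multiples of `Q` of degree at most
`2 n`, hence on every polynomial of that degree vanishing on the conic. So `L` lives on functions of
one variable: Laurent polynomials in `t = U` on the hyperbola, and pairs `(f, g)` with `f 0 = g 0`
on the two lines. Restrictions of degree at most `n` form a space of dimension `2 n + 1`. Thus the
rank is at most `2 n + 1`, with equality only if the kernel is trivial on the conic
(`solvable_of_frame`).

With trivial kernel the form is positive definite. On the hyperbola, Gauss quadrature with nodes
away from `t = 0` (`exists_gauss`) gives `2 n + 1` atoms. On the lines, the mass at the crossing
point must be shared between the axes. Each axis needs a minimal mass there (`exists_minimal_mass`),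
definiteness leaves a positive surplus, and halving the surplus makes both axes positive definite,
with `n + 1` nodes each.

With a nontrivial kernel the representation must have exactly rank many atoms. If the variety is
finite, rank at most its cardinality forces the kernel to be all polynomials of degree at most `n`
vanishing on it. A degree splitting carries the vanishing of `L` up to degree `2 n`, and
`exists_isAtomicRep` finds positive weights. The remaining case is a kernel vanishing on one whole
line. There a kernel element of minimal degree on the other line is essentially an orthogonal
polynomial; its roots are nodes, and the first line carries a Gauss formula
(`exists_rep_of_vanish_left`). -/

/-- A finite quadrature formula: a functional on an algebra which is positive on squares and
vanishes on everything vanishing at finitely many interpolation nodes is a positive combination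
of the evaluations at these nodes. -/
theorem exists_weights {A ι : Type*} [CommRing A] [Algebra ℝ A] (ev : ι → A →ₐ[ℝ] ℝ)
    (L : A →ₗ[ℝ] ℝ) (W W₂ : Submodule ℝ A) (hsq : ∀ a ∈ W, a ^ 2 ∈ W₂) (S : Finset ι)
    (interp : ∀ z ∈ S, ∃ a ∈ W, ev z a = 1 ∧ ∀ w ∈ S, w ≠ z → ev w a = 0)
    (vanish : ∀ a ∈ W₂, (∀ z ∈ S, ev z a = 0) → L a = 0)
    (pos : ∀ a ∈ W, (∃ z ∈ S, ev z a ≠ 0) → 0 < L (a ^ 2)) :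
    ∃ ρ : ι → ℝ, (∀ z ∈ S, 0 < ρ z) ∧ ∀ a ∈ W₂, L a = ∑ z ∈ S, ρ z * ev z a := by
  classical
  choose! l hlW hl1 hl0 using interp
  refine ⟨fun z => L (l z ^ 2), fun z hz => pos _ (hlW z hz) ⟨z, hz, by simp [hl1 z hz]⟩, ?_⟩
  intro a ha
  have h0 : L (a - ∑ z ∈ S, ev z a • l z ^ 2) = 0 := by
    refine vanish _ (W₂.sub_mem ha (W₂.sum_mem fun z hz =>
      W₂.smul_mem _ (hsq _ (hlW z hz)))) fun w hw => ?_
    rw [map_sub, map_sum, Finset.sum_eq_single w]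
    · simp [hl1 w hw]
    · intro z hz hzw
      simp [hl0 z hz w hw hzw.symm]
    · exact fun h => absurd hw h
  rw [map_sub, map_sum, sub_eq_zero] at h0
  rw [h0]
  exact Finset.sum_congr rfl fun z _ => by rw [map_smul, smul_eq_mul, mul_comm]

theorem dvd_of_eval_roots {h f : Polynomial ℝ} (hh : h ≠ 0) (hs : h.Splits) (hn : h.roots.Nodup)
    (hf : ∀ z ∈ h.roots, f.eval z = 0) : h ∣ f := by
  rcases eq_or_ne f 0 with rfl | hf0
  · exact dvd_zero _
  exact hs.dvd_of_roots_le_roots hh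
    ((Multiset.le_iff_subset hn).2 fun z hz => (Polynomial.mem_roots hf0).2 (hf z hz))

/-- If `h = g * q` with `g` an irreducible quadratic or `(X - z) ^ 2`, then `h * q = g * q ^ 2` is,
up to sign, a sum of squares of degree below that of `h`, contradicting `Λ (h * q) = 0`. Only such
`q`, of degree two less than `h`, are tested, so orthogonality may fail in the next degree. This
leaves a one-parameter freedom in the choice of `h`. -/
theorem splits_and_nodup_of_orthogonal (Λ : Polynomial ℝ →ₗ[ℝ] ℝ) {h : Polynomial ℝ} (h0 : h ≠ 0)
    (hort : ∀ q : Polynomial ℝ, q.natDegree + 2 ≤ h.natDegree → Λ (h * q) = 0)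
    (hpos : ∀ q : Polynomial ℝ, q ≠ 0 → q.natDegree < h.natDegree → 0 < Λ (q ^ 2)) :
    h.Splits ∧ h.roots.Nodup := by
  constructor
  · refine (Polynomial.splits_iff_splits).2 (Or.inr fun {g} hg hgh => ?_)
    have hg0 := hg.ne_zero
    by_contra hdeg
    have hd2 : g.natDegree = 2 := by
      have h1 := Polynomial.natDegree_le_of_degree_le (n := 2) hg.degree_le_two
      have h2 := hg.natDegree_pos
      have h3 : g.natDegree ≠ 1 := fun h => hdeg (by
        rw [Polynomial.degree_eq_natDegree hg0, h]; rfl)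
      omega
    obtain ⟨q, rfl⟩ := hgh
    have hq0 : q ≠ 0 := right_ne_zero_of_mul h0
    have hnd : (g * q).natDegree = 2 + q.natDegree := by
      rw [Polynomial.natDegree_mul hg0 hq0, hd2]
    set a := g.coeff 2
    set b := g.coeff 1
    set c := g.coeff 0
    have hga : a ≠ 0 := by
      have := Polynomial.leadingCoeff_ne_zero.2 hg0
      rwa [Polynomial.leadingCoeff, hd2] at this
    have hgeq : g = C a * X ^ 2 + C b * X + C c :=
      Polynomial.eq_quadratic_of_degree_le_two hg.degree_le_two
    have hdisc : b ^ 2 - 4 * a * c < 0 := by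
      by_contra! hnn
      have hroot : g.IsRoot ((-b + Real.sqrt (b ^ 2 - 4 * a * c)) / (2 * a)) := by
        have hs := Real.sq_sqrt hnn
        set r := Real.sqrt (b ^ 2 - 4 * a * c)
        rw [hgeq, Polynomial.IsRoot]
        simp only [Polynomial.eval_add, Polynomial.eval_mul, Polynomial.eval_C,
          Polynomial.eval_pow, Polynomial.eval_X]
        field_simp
        linear_combination hs
      exact hdeg (Polynomial.degree_eq_one_of_irreducible_of_root hg hroot)
    -- Completing the square in `g`; negative discriminant makes both square terms carry the sign of
    -- `a`.
    have key : g * q * q = a • ((X + C (b / (2 * a))) * q) ^ 2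
        + (a * ((4 * a * c - b ^ 2) / (4 * a ^ 2))) • q ^ 2 := by
      rw [hgeq, Polynomial.smul_eq_C_mul, Polynomial.smul_eq_C_mul]
      have e1 : C b = C a * (2 * C (b / (2 * a))) := by
        rw [show (2 : Polynomial ℝ) = C 2 from (map_ofNat C 2).symm, ← Polynomial.C_mul,
          ← Polynomial.C_mul]
        congr 1; field_simp
      have e2 : C c = C a * C (b / (2 * a)) ^ 2
          + C (a * ((4 * a * c - b ^ 2) / (4 * a ^ 2))) := by
        rw [← Polynomial.C_pow, ← Polynomial.C_mul, ← Polynomial.C_add]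
        congr 1; field_simp; ring
      rw [e1, e2]; ring
    have hz := hort q (by omega)
    rw [key, map_add, map_smul, map_smul, smul_eq_mul, smul_eq_mul, mul_assoc, ← mul_add] at hz
    have hX : (X + C (b / (2 * a)) : Polynomial ℝ) ≠ 0 := Polynomial.X_add_C_ne_zero _
    have p1 := hpos ((X + C (b / (2 * a))) * q) (mul_ne_zero hX hq0) (by
      rw [Polynomial.natDegree_mul hX hq0, Polynomial.natDegree_X_add_C]; omega)
    have p2 := hpos q hq0 (by omega)
    have p3 : 0 < (4 * a * c - b ^ 2) / (4 * a ^ 2) := div_pos (by linarith) (by positivity)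
    have p4 := mul_pos p3 p2
    rcases mul_eq_zero.1 hz with h | h
    · exact hga h
    · linarith
  · rw [Multiset.nodup_iff_count_le_one]
    intro z
    by_contra! hz
    rw [Polynomial.count_roots] at hz
    obtain ⟨q, rfl⟩ := (Polynomial.le_rootMultiplicity_iff h0).1 (Nat.succ_le_of_lt hz)
    have hq0 : q ≠ 0 := right_ne_zero_of_mul h0
    have hX : (X - C z : Polynomial ℝ) ≠ 0 := Polynomial.X_sub_C_ne_zero _
    have hnd : ((X - C z) ^ (Nat.succ 1) * q).natDegree = 2 + q.natDegree := by
      rw [Polynomial.natDegree_mul (pow_ne_zero _ hX) hq0, Polynomial.natDegree_pow,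
        Polynomial.natDegree_X_sub_C]
    have p1 := hpos ((X - C z) * q) (mul_ne_zero hX hq0) (by
      rw [hnd, Polynomial.natDegree_mul hX hq0, Polynomial.natDegree_X_sub_C]; omega)
    have := hort q (by omega)
    rw [show (X - C z) ^ (Nat.succ 1) * q * q = ((X - C z) * q) ^ 2 by
      rw [Nat.succ_eq_add_one]; ring] at this
    linarith

theorem mem_degreeLT_succ {N : ℕ} {q : Polynomial ℝ} :
    q ∈ Polynomial.degreeLT ℝ (N + 1) ↔ q.natDegree ≤ N := by
  rw [Polynomial.degreeLT_succ_eq_degreeLE, Polynomial.mem_degreeLE,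
    Polynomial.natDegree_le_iff_degree_le]

/-- Riesz representation for a positive definite form on the polynomials of degree `≤ N`. -/
theorem exists_riesz (Λ : Polynomial ℝ →ₗ[ℝ] ℝ) (N : ℕ)
    (hpos : ∀ q : Polynomial ℝ, q ≠ 0 → q.natDegree ≤ N → 0 < Λ (q ^ 2))
    (φ : Polynomial ℝ →ₗ[ℝ] ℝ) :
    ∃ k : Polynomial ℝ, k.natDegree ≤ N ∧
      ∀ q : Polynomial ℝ, q.natDegree ≤ N → Λ (k * q) = φ q := by
  let D := Polynomial.degreeLT ℝ (N + 1)
  let B : D →ₗ[ℝ] Module.Dual ℝ D :=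
    LinearMap.mk₂ ℝ (fun k q => Λ (k.1 * q.1))
      (fun a b c => by simp [add_mul]) (fun c a b => by simp)
      (fun a b c => by simp [mul_add]) (fun c a b => by simp)
  have : Module.Finite ℝ D := Module.Finite.equiv (Polynomial.degreeLTEquiv ℝ (N + 1)).symm
  have hinj : Function.Injective B := by
    rw [injective_iff_map_eq_zero]
    intro a ha
    by_contra h
    have h1 : B a a = 0 := by rw [ha]; rfl
    have h2 := hpos a.1 (fun h' => h (Subtype.ext h')) (mem_degreeLT_succ.1 a.2)
    rw [pow_two] at h2
    exact h2.ne' h1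
  have hsurj : Function.Surjective B :=
    (LinearMap.injective_iff_surjective_of_finrank_eq_finrank
      (Subspace.dual_finrank_eq (K := ℝ) (V := D)).symm).1 hinj
  obtain ⟨k, hk⟩ := hsurj (φ ∘ₗ D.subtype)
  exact ⟨k.1, mem_degreeLT_succ.1 k.2, fun q hq =>
    LinearMap.congr_fun hk ⟨q, mem_degreeLT_succ.2 hq⟩⟩

/-- An orthogonal polynomial of degree `N + 1` which does not vanish at `0`. -/
theorem exists_orthogonal (Λ : Polynomial ℝ →ₗ[ℝ] ℝ) (N : ℕ)
    (hpos : ∀ q : Polynomial ℝ, q ≠ 0 → q.natDegree ≤ N → 0 < Λ (q ^ 2)) :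
    ∃ P : Polynomial ℝ, P.natDegree = N + 1 ∧ P.coeff 0 ≠ 0 ∧
      ∀ q : Polynomial ℝ, q.natDegree + 2 ≤ N + 1 → Λ (P * q) = 0 := by
  -- The free parameter `c` plays the role of the undetermined moment of degree `2 N + 1`. At most
  -- one of the choices `c = 0` and `c = 1` can give a polynomial vanishing at `0`.
  have key : ∀ c : ℝ, ∃ P : Polynomial ℝ, P.natDegree = N + 1 ∧ P.coeff (N + 1) = 1 ∧
      ∀ q : Polynomial ℝ, q.natDegree ≤ N → Λ (P * q) = c * q.coeff N := by
    intro c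
    obtain ⟨R, hR, h⟩ := exists_riesz Λ N hpos
      (c • Polynomial.lcoeff ℝ N - Λ ∘ₗ LinearMap.mulLeft ℝ (X ^ (N + 1)))
    have hc : (X ^ (N + 1) + R).coeff (N + 1) = 1 := by
      rw [Polynomial.coeff_add, Polynomial.coeff_X_pow_self,
        Polynomial.coeff_eq_zero_of_natDegree_lt (by omega), add_zero]
    refine ⟨X ^ (N + 1) + R, ?_, hc, fun q hq => ?_⟩
    · refine le_antisymm ?_ (Polynomial.le_natDegree_of_ne_zero (by rw [hc]; exact one_ne_zero))
      refine (Polynomial.natDegree_add_le _ _).trans ?_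
      rw [Polynomial.natDegree_X_pow]
      omega
    · rw [add_mul, map_add, h q hq]
      simp
  obtain ⟨P₀, hd₀, hc₀, h₀⟩ := key 0
  obtain ⟨P₁, hd₁, hc₁, h₁⟩ := key 1
  by_cases hz₀ : P₀.coeff 0 = 0
  swap
  · exact ⟨P₀, hd₀, hz₀, fun q hq => by rw [h₀ q (by omega), zero_mul]⟩
  by_cases hz₁ : P₁.coeff 0 = 0
  swap
  · exact ⟨P₁, hd₁, hz₁, fun q hq => by
      rw [h₁ q (by omega), Polynomial.coeff_eq_zero_of_natDegree_lt (by omega), mul_zero]⟩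
  exfalso
  obtain ⟨p, rfl⟩ := Polynomial.X_dvd_iff.2 hz₀
  have hz : (P₁ - X * p).coeff 0 = 0 := by rw [Polynomial.coeff_sub, hz₀, hz₁, sub_zero]
  obtain ⟨k, hk⟩ := Polynomial.X_dvd_iff.2 hz
  have hp0 : p ≠ 0 := by rintro rfl; simp at hd₀
  have hpd : p.natDegree = N := by
    rw [Polynomial.natDegree_X_mul hp0] at hd₀; omega
  -- With `P₀ = X * p` and `P₁ - P₀ = X * k`, the value `Λ (X * k * p)` is `1` by the defining
  -- property of the difference, and `0` because `P₀` is orthogonal to `k`.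
  have e1 : Λ (X * k * p) = 1 := by
    rw [← hk, sub_mul, map_sub, h₁ p hpd.le, h₀ p hpd.le]
    rw [Polynomial.coeff_X_mul] at hc₀
    simp [hc₀]
  have hk0 : k ≠ 0 := by rintro rfl; simp at e1
  have hkd : k.natDegree + 1 ≤ N := by
    rw [← Polynomial.natDegree_X_mul hk0, ← hk]
    refine Polynomial.natDegree_le_iff_coeff_eq_zero.2 fun m hm => ?_
    rcases eq_or_ne m (N + 1) with rfl | hne
    · rw [Polynomial.coeff_sub, hc₀, hc₁, sub_self]
    · rw [Polynomial.coeff_sub, Polynomial.coeff_eq_zero_of_natDegree_lt (by omega),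
        Polynomial.coeff_eq_zero_of_natDegree_lt (by omega), sub_self]
  have e2 := h₀ k (by omega)
  rw [zero_mul, show X * p * k = X * k * p by ring] at e2
  rw [e2] at e1
  exact zero_ne_one e1

/-- Gauss quadrature, with nodes different from `0`. -/
theorem exists_gauss (Λ : Polynomial ℝ →ₗ[ℝ] ℝ) (N : ℕ)
    (hpos : ∀ q : Polynomial ℝ, q ≠ 0 → q.natDegree ≤ N → 0 < Λ (q ^ 2)) :
    ∃ (S : Finset ℝ) (ρ : ℝ → ℝ), S.card = N + 1 ∧ 0 ∉ S ∧ (∀ z ∈ S, 0 < ρ z) ∧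
      ∀ f : Polynomial ℝ, f.natDegree ≤ 2 * N → Λ f = ∑ z ∈ S, ρ z * f.eval z := by
  obtain ⟨P, hd, hc, hP⟩ := exists_orthogonal Λ N hpos
  have hP0 : P ≠ 0 := by rintro rfl; simp at hc
  obtain ⟨hs, hn⟩ := splits_and_nodup_of_orthogonal Λ hP0 (by rw [hd]; exact hP)
    (fun q hq hqd => hpos q hq (by omega))
  have hcard : P.roots.toFinset.card = N + 1 := by
    rw [Multiset.toFinset_card_of_nodup hn, Polynomial.splits_iff_card_roots.1 hs, hd]
  obtain ⟨ρ, hρ, hΛ⟩ := exists_weights (fun z : ℝ => Polynomial.aeval (R := ℝ) z) Λ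
    (Polynomial.degreeLT ℝ (N + 1)) (Polynomial.degreeLT ℝ (2 * N + 1))
    (fun a ha => by
      rw [mem_degreeLT_succ] at ha ⊢
      exact Polynomial.natDegree_pow_le.trans (by omega))
    P.roots.toFinset
    (fun z hz => by
      refine ⟨Lagrange.basis P.roots.toFinset id z, ?_, ?_, fun w hw hwz => ?_⟩
      · rw [mem_degreeLT_succ, Lagrange.natDegree_basis (Set.injOn_id _) hz]
        omega
      · exact Lagrange.eval_basis_self (v := id) (Set.injOn_id _) hz
      · exact Lagrange.eval_basis_of_ne (v := id) hwz.symm hw)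
    (fun f hf h => by
      obtain ⟨q, rfl⟩ := dvd_of_eval_roots (f := f) hP0 hs hn
        (fun z hz => h z (Multiset.mem_toFinset.2 hz))
      rcases eq_or_ne q 0 with rfl | hq0
      · simp
      · rw [mem_degreeLT_succ, Polynomial.natDegree_mul hP0 hq0] at hf
        exact hP q (by omega))
    (fun a ha ⟨z, _, hz⟩ => hpos a (by rintro rfl; simp at hz) (mem_degreeLT_succ.1 ha))
  refine ⟨P.roots.toFinset, ρ, hcard, ?_, hρ, fun f hf => hΛ f (mem_degreeLT_succ.2 hf)⟩
  rw [Multiset.mem_toFinset, Polynomial.mem_roots hP0, Polynomial.IsRoot,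
    ← Polynomial.coeff_zero_eq_eval_zero]
  exact hc

end HypMoment

/-! ### The moment matrix as a bilinear form -/

namespace HypMoment

open MvPolynomial

/-- The Riesz functional `y ^ i * x ^ j ↦ β i j`. -/
noncomputable def riesz (β : ℕ → ℕ → ℝ) : Poly →ₗ[ℝ] ℝ :=
  (MvPolynomial.basisMonomials (Fin 2) ℝ).constr ℝ fun m => β (m 1) (m 0)

theorem mem_exps {n : ℕ} {e : ℕ × ℕ} : e ∈ exps n ↔ e.1 + e.2 ≤ n := by
  simp only [exps, Finset.mem_filter, Finset.mem_product, Finset.mem_range]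
  omega

/-- The monomial `y ^ e.1 * x ^ e.2`. -/
noncomputable def mon (e : ℕ × ℕ) : Poly := X 1 ^ e.1 * X 0 ^ e.2

theorem mon_eq_monomial (e : ℕ × ℕ) :
    mon e = monomial (Finsupp.single 1 e.1 + Finsupp.single 0 e.2) 1 := by
  rw [mon, X_pow_eq_monomial, X_pow_eq_monomial, monomial_mul, one_mul]

theorem riesz_mon (β : ℕ → ℕ → ℝ) (e : ℕ × ℕ) : riesz β (mon e) = β e.1 e.2 := by
  rw [mon_eq_monomial, riesz]
  exact (Module.Basis.constr_basis _ ℝ _ _).trans (by simp)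

theorem mon_mul (e f : ℕ × ℕ) : mon e * mon f = mon (e + f) := by
  simp only [mon, Prod.fst_add, Prod.snd_add]; ring

theorem totalDegree_mon (e : ℕ × ℕ) : (mon e).totalDegree ≤ e.1 + e.2 := by
  rw [mon]
  refine (totalDegree_mul _ _).trans ?_
  rw [totalDegree_X_pow, totalDegree_X_pow]

/-- The polynomial with a given vector of coefficients. -/
noncomputable def ofCoeffs (n : ℕ) : (Idx n → ℝ) →ₗ[ℝ] Poly :=
  Fintype.linearCombination ℝ (fun e : Idx n => mon e.1)

theorem ofCoeffs_apply {n : ℕ} (v : Idx n → ℝ) : ofCoeffs n v = ∑ e : Idx n, v e • mon e.1 :=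
  rfl

theorem totalDegree_ofCoeffs {n : ℕ} (v : Idx n → ℝ) : (ofCoeffs n v).totalDegree ≤ n :=
  totalDegree_finsetSum_le fun e _ =>
    (totalDegree_smul_le _ _).trans ((totalDegree_mon _).trans (mem_exps.1 e.2))

theorem coeffYX_mon (e : ℕ × ℕ) (i j : ℕ) :
    coeffYX (mon e) i j = if (i, j) = e then 1 else 0 := by
  rw [coeffYX, mon_eq_monomial, coeff_monomial]
  congr 1
  obtain ⟨a, b⟩ := e
  simp only [Prod.mk.injEq, eq_iff_iff]
  constructor
  · intro h
    have h0 := DFunLike.congr_fun h 0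
    have h1 := DFunLike.congr_fun h 1
    simp at h0 h1
    exact ⟨h1.symm, h0.symm⟩
  · rintro ⟨rfl, rfl⟩; rfl

theorem eq_ofCoeffs {n : ℕ} {p : Poly} (hp : p.totalDegree ≤ n) :
    p = ofCoeffs n fun e => coeffYX p e.1.1 e.1.2 := by
  refine MvPolynomial.ext _ _ fun m => ?_
  have hm : m = Finsupp.single 1 (m 1) + Finsupp.single 0 (m 0) := by
    ext i; fin_cases i <;> simp
  have hR : ∀ q : Poly, coeff m q = coeffYX q (m 1) (m 0) := fun q => by
    rw [coeffYX, ← hm]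
  rw [hR (ofCoeffs n _), ofCoeffs_apply]
  have hsum : ∀ (s : Finset (Idx n)) (f : Idx n → Poly) (i j : ℕ),
      coeffYX (∑ e ∈ s, f e) i j = ∑ e ∈ s, coeffYX (f e) i j := fun s f i j => coeff_sum _ _ _
  have hsmul : ∀ (c : ℝ) (q : Poly) (i j : ℕ), coeffYX (c • q) i j = c * coeffYX q i j :=
    fun c q i j => coeff_smul _ _ _
  rw [hsum]
  simp only [hsmul, coeffYX_mon]
  by_cases h : m 1 + m 0 ≤ n
  · rw [Finset.sum_eq_single (⟨(m 1, m 0), mem_exps.2 h⟩ : Idx n)]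
    · simp [hR p]
    · intro e _ he
      rw [if_neg (fun h' => he (Subtype.ext h'.symm)), mul_zero]
    · simp
  · rw [Finset.sum_eq_zero]
    · apply coeff_eq_zero_of_totalDegree_lt
      refine lt_of_le_of_lt hp (lt_of_lt_of_le (not_le.1 h) (le_of_eq ?_))
      rw [← Finsupp.degree_apply, Finsupp.degree_eq_sum, Fin.sum_univ_two, add_comm]
    · intro e _
      rw [if_neg, mul_zero]
      intro h'
      have := mem_exps.1 e.2
      rw [← h'] at this
      exact h this

/-- The dictionary between the matrix and the functional, from which the descriptions of kernel and
positivity follow. -/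
theorem riesz_ofCoeffs_mul (n : ℕ) (β : ℕ → ℕ → ℝ) (v w : Idx n → ℝ) :
    riesz β (ofCoeffs n v * ofCoeffs n w) = dotProduct v ((momentMatrix n β).mulVec w) := by
  rw [ofCoeffs_apply, ofCoeffs_apply, Finset.sum_mul_sum]
  simp only [map_sum, dotProduct, Matrix.mulVec, Finset.mul_sum, smul_mul_smul_comm,
    mon_mul, map_smul, riesz_mon, smul_eq_mul, momentMatrix, Matrix.of_apply, Prod.fst_add, Prod.snd_add]
  exact Finset.sum_congr rfl fun i _ => Finset.sum_congr rfl fun j _ => by ring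

theorem polyCol_eq_mulVec (n : ℕ) (β : ℕ → ℕ → ℝ) (p : Poly) :
    polyCol n β p = (momentMatrix n β).mulVec fun e => coeffYX p e.1.1 e.1.2 := by
  ext r
  simp [polyCol, Matrix.mulVec, dotProduct, mul_comm]

/-- The polynomials of degree at most `n` in the kernel of the moment matrix of a functional. -/
def Ker (n : ℕ) (L : Poly →ₗ[ℝ] ℝ) (p : Poly) : Prop :=
  p.totalDegree ≤ n ∧ ∀ q : Poly, q.totalDegree ≤ n → L (p * q) = 0

theorem ker_iff (n : ℕ) (β : ℕ → ℕ → ℝ) (v : Idx n → ℝ) :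
    Ker n (riesz β) (ofCoeffs n v) ↔ (momentMatrix n β).mulVec v = 0 := by
  constructor
  · intro h
    refine dotProduct_eq_zero _ fun w => ?_
    rw [dotProduct_comm, ← riesz_ofCoeffs_mul, mul_comm]
    exact h.2 _ (totalDegree_ofCoeffs w)
  · intro h
    refine ⟨totalDegree_ofCoeffs v, fun q hq => ?_⟩
    rw [eq_ofCoeffs hq, mul_comm, riesz_ofCoeffs_mul, h, dotProduct_zero]

theorem ker_iff_polyCol (n : ℕ) (β : ℕ → ℕ → ℝ) {p : Poly} (hp : p.totalDegree ≤ n) :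
    Ker n (riesz β) p ↔ polyCol n β p = 0 := by
  rw [polyCol_eq_mulVec, ← ker_iff, ← eq_ofCoeffs hp]

theorem posSemidef_iff (n : ℕ) (β : ℕ → ℕ → ℝ) :
    (momentMatrix n β).PosSemidef ↔
      ∀ p : Poly, p.totalDegree ≤ n → 0 ≤ riesz β (p ^ 2) := by
  rw [Matrix.posSemidef_iff_dotProduct_mulVec]
  constructor
  · intro h p hp
    have := h.2 (fun e => coeffYX p e.1.1 e.1.2)
    rw [star_trivial, ← riesz_ofCoeffs_mul, ← eq_ofCoeffs hp, ← pow_two] at this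
    exact this
  · intro h
    refine ⟨?_, fun v => ?_⟩
    · ext i j
      simp [momentMatrix, Matrix.conjTranspose, add_comm]
    · rw [star_trivial, ← riesz_ofCoeffs_mul, ← pow_two]
      exact h _ (totalDegree_ofCoeffs v)

/-! ### Rank against point evaluations -/

/-- Evaluation at a point `(x, y)` of the plane. -/
noncomputable def ev (z : ℝ × ℝ) : Poly →ₐ[ℝ] ℝ := aeval ![z.1, z.2]

theorem mem_zeroSet {p : Poly} {z : ℝ × ℝ} : z ∈ zeroSet p ↔ ev z p = 0 := Iff.rfl

theorem ev_mon (e : ℕ × ℕ) (z : ℝ × ℝ) : ev z (mon e) = z.2 ^ e.1 * z.1 ^ e.2 := by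
  simp [ev, mon]

/-- Arbitrary values on `S` are interpolated by polynomials of degree at most `n`. -/
def Interp (n : ℕ) (S : Finset (ℝ × ℝ)) : Prop :=
  ∀ f : ℝ × ℝ → ℝ, ∃ p : Poly, p.totalDegree ≤ n ∧ ∀ z ∈ S, ev z p = f z

section rank

variable {n : ℕ} {β : ℕ → ℕ → ℝ} {S : Finset (ℝ × ℝ)}

/-- The evaluations at the points of `S`, on coefficient vectors. -/
noncomputable def evals (n : ℕ) (S : Finset (ℝ × ℝ)) : (Idx n → ℝ) →ₗ[ℝ] (S → ℝ) :=
  LinearMap.pi fun z => (ev z.1).toLinearMap ∘ₗ ofCoeffs n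

theorem evals_eq_zero {v : Idx n → ℝ} :
    evals n S v = 0 ↔ ∀ z ∈ S, ev z (ofCoeffs n v) = 0 := by
  rw [funext_iff]
  exact Subtype.forall

theorem evals_surjective (h : Interp n S) : Function.Surjective (evals n S) := by
  intro f
  classical
  obtain ⟨p, hp, hpf⟩ := h fun z => if hz : z ∈ S then f ⟨z, hz⟩ else 0
  refine ⟨fun e => coeffYX p e.1.1 e.1.2, ?_⟩
  ext ⟨z, hz⟩
  change ev z (ofCoeffs n _) = _
  rw [← eq_ofCoeffs hp, hpf z hz, dif_pos hz]

theorem rank_add_finrank_ker (n : ℕ) (β : ℕ → ℕ → ℝ) :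
    (momentMatrix n β).rank + Module.finrank ℝ (LinearMap.ker (momentMatrix n β).mulVecLin)
      = Fintype.card (Idx n) := by
  rw [Matrix.rank, LinearMap.finrank_range_add_finrank_ker, Module.finrank_fintype_fun_eq_card]

theorem finrank_range_evals (n : ℕ) (S : Finset (ℝ × ℝ)) :
    Module.finrank ℝ (LinearMap.range (evals n S)) +
      Module.finrank ℝ (LinearMap.ker (evals n S)) = Fintype.card (Idx n) := by
  rw [LinearMap.finrank_range_add_finrank_ker, Module.finrank_fintype_fun_eq_card]

theorem finrank_range_evals_le (n : ℕ) (S : Finset (ℝ × ℝ)) :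
    Module.finrank ℝ (LinearMap.range (evals n S)) ≤ S.card := by
  refine (Submodule.finrank_le _).trans ?_
  rw [Module.finrank_fintype_fun_eq_card, Fintype.card_coe]

theorem finrank_range_evals_eq (h : Interp n S) :
    Module.finrank ℝ (LinearMap.range (evals n S)) = S.card := by
  rw [LinearMap.range_eq_top.2 (evals_surjective h), finrank_top,
    Module.finrank_fintype_fun_eq_card, Fintype.card_coe]

theorem ker_evals_le_iff :
    LinearMap.ker (evals n S) ≤ LinearMap.ker (momentMatrix n β).mulVecLin ↔
      ∀ p : Poly, p.totalDegree ≤ n → (∀ z ∈ S, ev z p = 0) → Ker n (riesz β) p := by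
  constructor
  · intro h p hp hz
    have hp' := eq_ofCoeffs hp
    rw [hp'] at hz ⊢
    exact (ker_iff _ _ _).2 (h (evals_eq_zero.2 hz))
  · intro h v hv
    exact (ker_iff _ _ _).1 (h _ (totalDegree_ofCoeffs v) (evals_eq_zero.1 hv))

theorem ker_le_ker_evals_iff :
    LinearMap.ker (momentMatrix n β).mulVecLin ≤ LinearMap.ker (evals n S) ↔
      ∀ p : Poly, Ker n (riesz β) p → ∀ z ∈ S, ev z p = 0 := by
  constructor
  · intro h p hp
    have hp' := eq_ofCoeffs hp.1
    rw [hp'] at hp ⊢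
    exact evals_eq_zero.1 (h ((ker_iff _ _ _).1 hp))
  · intro h v hv
    exact evals_eq_zero.2 (h _ ((ker_iff _ _ _).2 hv))

/-- This and the next three lemmas compare the kernel of the matrix with that of evaluation on `S`
inside one coefficient space. An inclusion compares the rank with the number of points; an inclusion
together with the opposite rank inequality is an equality. -/
theorem rank_le_card
    (h : ∀ p : Poly, p.totalDegree ≤ n → (∀ z ∈ S, ev z p = 0) → Ker n (riesz β) p) :
    (momentMatrix n β).rank ≤ S.card := by
  have h1 := Submodule.finrank_mono (ker_evals_le_iff.2 h)
  have h2 := rank_add_finrank_ker n β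
  have h3 := finrank_range_evals n S
  have h4 := finrank_range_evals_le n S
  omega

theorem card_le_rank (hS : Interp n S)
    (h : ∀ p : Poly, Ker n (riesz β) p → ∀ z ∈ S, ev z p = 0) :
    S.card ≤ (momentMatrix n β).rank := by
  have h1 := Submodule.finrank_mono (ker_le_ker_evals_iff.2 h)
  have h2 := rank_add_finrank_ker n β
  have h3 := finrank_range_evals n S
  have h4 := finrank_range_evals_eq hS
  omega

theorem ker_of_rank_le_card (hS : Interp n S)
    (h : ∀ p : Poly, Ker n (riesz β) p → ∀ z ∈ S, ev z p = 0)
    (hr : (momentMatrix n β).rank ≤ S.card) :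
    ∀ p : Poly, p.totalDegree ≤ n → (∀ z ∈ S, ev z p = 0) → Ker n (riesz β) p := by
  have h2 := rank_add_finrank_ker n β
  have h3 := finrank_range_evals n S
  have h4 := finrank_range_evals_eq hS
  exact ker_evals_le_iff.1
    (Submodule.eq_of_le_of_finrank_le (ker_le_ker_evals_iff.2 h) (by omega)).ge

theorem eval_eq_zero_of_card_le_rank
    (h : ∀ p : Poly, p.totalDegree ≤ n → (∀ z ∈ S, ev z p = 0) → Ker n (riesz β) p)
    (hr : S.card ≤ (momentMatrix n β).rank) :
    ∀ p : Poly, Ker n (riesz β) p → ∀ z ∈ S, ev z p = 0 := by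
  have h2 := rank_add_finrank_ker n β
  have h3 := finrank_range_evals n S
  have h4 := finrank_range_evals_le n S
  exact ker_le_ker_evals_iff.1
    (Submodule.eq_of_le_of_finrank_le (ker_evals_le_iff.2 h) (by omega)).ge

end rank

/-! ### Affine coordinates and functionals on the conic `U V = κ` -/

/-- Affine coordinates `(U, V)` on the plane; `pt u v` is the point with coordinates `(u, v)`. -/
structure Coords where
  U : Poly
  V : Poly
  degU : U.totalDegree ≤ 1
  degV : V.totalDegree ≤ 1
  pt : ℝ → ℝ → ℝ × ℝ
  ev_U : ∀ u v, ev (pt u v) U = u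
  ev_V : ∀ u v, ev (pt u v) V = v
  pt_ev : ∀ z, pt (ev z U) (ev z V) = z
  memX : ∀ i, (X i : Poly) ∈ Submodule.span ℝ {1, U, V}

namespace Coords

/-- The coordinates with their roles exchanged. -/
def swap (c : Coords) : Coords where
  U := c.V
  V := c.U
  degU := c.degV
  degV := c.degU
  pt := fun u v => c.pt v u
  ev_U := fun u v => c.ev_V v u
  ev_V := fun u v => c.ev_U v u
  pt_ev := c.pt_ev
  memX := fun i => by rw [Set.pair_comm]; exact c.memX i

theorem exists_of_det_ne_zero (a₁ b₁ c₁ a₂ b₂ c₂ : ℝ) (h : a₁ * b₂ - a₂ * b₁ ≠ 0) :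
    ∃ c : Coords, c.U = C a₁ * X 0 + C b₁ * X 1 + C c₁ ∧
      c.V = C a₂ * X 0 + C b₂ * X 1 + C c₂ := by
  have hdeg : ∀ a b d : ℝ, (C a * X 0 + C b * X 1 + C d : Poly).totalDegree ≤ 1 := by
    intro a b d
    have h1 : ∀ (e : ℝ) (i : Fin 2), (C e * X i : Poly).totalDegree ≤ 1 := fun e i =>
      (totalDegree_mul _ _).trans (by rw [totalDegree_C, totalDegree_X])
    refine (totalDegree_add _ _).trans (max_le ((totalDegree_add _ _).trans
      (max_le (h1 a 0) (h1 b 1))) ?_)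
    rw [totalDegree_C]; exact zero_le_one
  have hev : ∀ (a b d : ℝ) (z : ℝ × ℝ),
      ev z (C a * X 0 + C b * X 1 + C d : Poly) = a * z.1 + b * z.2 + d := by
    intro a b d z
    simp [ev]
  set D := a₁ * b₂ - a₂ * b₁ with hD
  refine ⟨⟨C a₁ * X 0 + C b₁ * X 1 + C c₁, C a₂ * X 0 + C b₂ * X 1 + C c₂, hdeg _ _ _, hdeg _ _ _,
    fun u v => ((b₂ * (u - c₁) - b₁ * (v - c₂)) / D, (a₁ * (v - c₂) - a₂ * (u - c₁)) / D),
    ?_, ?_, ?_, ?_⟩, rfl, rfl⟩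
  · intro u v
    rw [hev]; field_simp; rw [hD]; ring
  · intro u v
    rw [hev]; field_simp; rw [hD]; ring
  · intro z
    rw [hev, hev]
    ext
    · field_simp; rw [hD]; ring
    · field_simp; rw [hD]; ring
  · have key : ∀ (p : Poly) (r s t : ℝ),
        p = C r * 1 + (C s * (C a₁ * X 0 + C b₁ * X 1 + C c₁) +
          C t * (C a₂ * X 0 + C b₂ * X 1 + C c₂)) →
        p ∈ Submodule.span ℝ {1, C a₁ * X 0 + C b₁ * X 1 + C c₁,
          C a₂ * X 0 + C b₂ * X 1 + C c₂} := by
      intro p r s t hp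
      rw [Submodule.mem_span_insert]
      exact ⟨r, _, Submodule.mem_span_pair.2 ⟨s, t, rfl⟩, by rw [hp]; simp only [smul_eq_C_mul]⟩
    intro i
    fin_cases i
    · refine key _ (-(b₂ * c₁ - b₁ * c₂) / D) (b₂ / D) (-b₁ / D) ?_
      have e1 : b₂ / D * a₁ + -b₁ / D * a₂ = 1 := by field_simp; rw [hD]; ring
      have e2 : b₂ / D * b₁ + -b₁ / D * b₂ = 0 := by field_simp; ring
      have e3 : -(b₂ * c₁ - b₁ * c₂) / D + (b₂ / D * c₁ + -b₁ / D * c₂) = 0 := by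
        field_simp; ring
      have f1 := congrArg (C : ℝ → Poly) e1
      have f2 := congrArg (C : ℝ → Poly) e2
      have f3 := congrArg (C : ℝ → Poly) e3
      simp only [map_add, map_mul, map_one, map_zero] at f1 f2 f3
      change (X 0 : Poly) = _
      linear_combination (-X 0) * f1 - X 1 * f2 - f3
    · refine key _ (-(a₁ * c₂ - a₂ * c₁) / D) (-a₂ / D) (a₁ / D) ?_
      have e1 : -a₂ / D * a₁ + a₁ / D * a₂ = 0 := by field_simp; ring
      have e2 : -a₂ / D * b₁ + a₁ / D * b₂ = 1 := by field_simp; rw [hD]; ring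
      have e3 : -(a₁ * c₂ - a₂ * c₁) / D + (-a₂ / D * c₁ + a₁ / D * c₂) = 0 := by
        field_simp; ring
      have f1 := congrArg (C : ℝ → Poly) e1
      have f2 := congrArg (C : ℝ → Poly) e2
      have f3 := congrArg (C : ℝ → Poly) e3
      simp only [map_add, map_mul, map_one, map_zero] at f1 f2 f3
      change (X 1 : Poly) = _
      linear_combination (-X 0) * f1 - X 1 * f2 - f3

variable (c : Coords)

theorem ext_iff' {z w : ℝ × ℝ} : z = w ↔ ev z c.U = ev w c.U ∧ ev z c.V = ev w c.V :=
  ⟨fun h => by rw [h]; exact ⟨rfl, rfl⟩, fun ⟨h1, h2⟩ => by rw [← c.pt_ev z, ← c.pt_ev w, h1, h2]⟩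

theorem totalDegree_monomial_le (i j : ℕ) : (c.U ^ i * c.V ^ j).totalDegree ≤ i + j := by
  refine (totalDegree_mul _ _).trans (add_le_add ?_ ?_)
  · exact (totalDegree_pow _ _).trans (by nlinarith [c.degU])
  · exact (totalDegree_pow _ _).trans (by nlinarith [c.degV])

/-- A polynomial of degree at most `m` is a combination of the monomials of degree at most `m`
in the coordinates. -/
theorem mem_of_monomials {m : ℕ} {T : Submodule ℝ Poly}
    (hT : ∀ i j, i + j ≤ m → c.U ^ i * c.V ^ j ∈ T) {p : Poly} (hp : p.totalDegree ≤ m) :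
    p ∈ T := by
  have hpow : ∀ k, ∀ q ∈ (Submodule.span ℝ ({1, c.U, c.V} : Set Poly)) ^ k,
      q ∈ Submodule.span ℝ {q | ∃ i j, i + j ≤ k ∧ q = c.U ^ i * c.V ^ j} := by
    intro k
    induction k with
    | zero =>
      intro q hq
      rw [pow_zero, Submodule.mem_one] at hq
      obtain ⟨r, rfl⟩ := hq
      rw [Algebra.algebraMap_eq_smul_one]
      exact Submodule.smul_mem _ _ (Submodule.subset_span ⟨0, 0, le_rfl, by simp⟩)
    | succ k ih =>
      intro q hq
      rw [pow_succ] at hq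
      refine Submodule.mul_induction_on hq (fun a ha b hb => ?_) (fun a b => Submodule.add_mem _)
      have h1 := Submodule.mul_mem_mul (ih a ha) hb
      rw [Submodule.span_mul_span] at h1
      refine Submodule.span_mono ?_ h1
      rintro _ ⟨_, ⟨i, j, hij, rfl⟩, b, (rfl | rfl | rfl), rfl⟩
      · exact ⟨i, j, by omega, mul_one _⟩
      · exact ⟨i + 1, j, by omega, by simp only; ring⟩
      · exact ⟨i, j + 1, by omega, by simp only; ring⟩
  have hle : ∀ k, k ≤ m → ∀ q ∈ (Submodule.span ℝ ({1, c.U, c.V} : Set Poly)) ^ k, q ∈ T := by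
    intro k hk q hq
    refine Submodule.span_le.2 ?_ (hpow k q hq)
    rintro _ ⟨i, j, hij, rfl⟩
    exact hT i j (by omega)
  rw [eq_ofCoeffs hp, ofCoeffs_apply]
  refine T.sum_mem fun e _ => T.smul_mem _ (hle (e.1.1 + e.1.2) (mem_exps.1 e.2) _ ?_)
  rw [mon, pow_add]
  exact Submodule.mul_mem_mul (Submodule.pow_mem_pow _ (c.memX 1) _)
    (Submodule.pow_mem_pow _ (c.memX 0) _)

/-- Modulo `U V - κ`, a mixed monomial loses one factor `U` and one factor `V` at the cost of `κ`,
so only pure powers survive; the multiplier used always has degree at most `m - 2`. -/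
theorem mem_of_generators {m : ℕ} {κ : ℝ} {T : Submodule ℝ Poly} (hU : ∀ i ≤ m, c.U ^ i ∈ T)
    (hV : ∀ j ≤ m, c.V ^ j ∈ T)
    (hR : ∀ r : Poly, r.totalDegree + 2 ≤ m → (c.U * c.V - C κ) * r ∈ T)
    {p : Poly} (hp : p.totalDegree ≤ m) : p ∈ T := by
  refine c.mem_of_monomials (fun i => ?_) hp
  induction i with
  | zero =>
    intro j hj
    rw [pow_zero, one_mul]
    exact hV j (by omega)
  | succ i ih =>
    rintro (_ | j) hj
    · rw [pow_zero, mul_one]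
      exact hU _ (by omega)
    · have h1 := T.add_mem (hR (c.U ^ i * c.V ^ j) (by
        have := c.totalDegree_monomial_le i j; omega)) (T.smul_mem κ (ih j (by omega)))
      convert h1 using 1
      rw [smul_eq_C_mul]; ring

/-- The conic `U V = κ`. -/
def conic (κ : ℝ) : Set (ℝ × ℝ) := {z | ev z c.U * ev z c.V = κ}

theorem pt_mem_conic {κ u v : ℝ} : c.pt u v ∈ c.conic κ ↔ u * v = κ := by
  rw [conic, Set.mem_ofPred_eq, c.ev_U, c.ev_V]

theorem ev_sub_of_mem_conic {κ : ℝ} {z : ℝ × ℝ} (hz : z ∈ c.conic κ) :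
    ev z (c.U * c.V - C κ) = 0 := by
  rw [map_sub, map_mul, hz, ← algebraMap_eq, AlgHom.commutes]
  exact sub_self κ

/-- The polynomials in the kernel of `L` which vanish on the conic. -/
noncomputable def kerVanishing (κ : ℝ) (L : Poly →ₗ[ℝ] ℝ) : Submodule ℝ Poly :=
  LinearMap.ker L ⊓ ⨅ z ∈ c.conic κ, LinearMap.ker (ev z).toLinearMap

theorem mem_kerVanishing {κ : ℝ} {L : Poly →ₗ[ℝ] ℝ} {p : Poly} :
    p ∈ c.kerVanishing κ L ↔ L p = 0 ∧ ∀ z ∈ c.conic κ, ev z p = 0 := by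
  simp [kerVanishing]

theorem ev_aeval_U (u v : ℝ) (f : Polynomial ℝ) :
    ev (c.pt u v) (Polynomial.aeval c.U f) = f.eval u := by
  rw [← Polynomial.aeval_algHom_apply, c.ev_U]; rfl

theorem ev_aeval_V (u v : ℝ) (f : Polynomial ℝ) :
    ev (c.pt u v) (Polynomial.aeval c.V f) = f.eval v :=
  c.swap.ev_aeval_U v u f

theorem totalDegree_aeval_U_le {f : Polynomial ℝ} {m : ℕ} (hf : f.natDegree ≤ m) :
    (Polynomial.aeval c.U f).totalDegree ≤ m := by
  rw [Polynomial.aeval_eq_sum_range]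
  refine totalDegree_finsetSum_le fun i hi => (totalDegree_smul_le _ _).trans ?_
  have := c.totalDegree_monomial_le i 0
  rw [pow_zero, mul_one] at this
  rw [Finset.mem_range] at hi
  omega

theorem totalDegree_aeval_V_le {f : Polynomial ℝ} {m : ℕ} (hf : f.natDegree ≤ m) :
    (Polynomial.aeval c.V f).totalDegree ≤ m := c.swap.totalDegree_aeval_U_le hf

/-- On a pair of lines, a functional which vanishes on the multiples of the equation vanishes on
every polynomial which vanishes on the lines. -/
theorem apply_eq_zero_of_conic_zero {m : ℕ} {L : Poly →ₗ[ℝ] ℝ}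
    (hL : ∀ r : Poly, r.totalDegree + 2 ≤ m → L ((c.U * c.V - C 0) * r) = 0)
    {p : Poly} (hp : p.totalDegree ≤ m) (h : ∀ z ∈ c.conic 0, ev z p = 0) : L p = 0 := by
  have hmem : p ∈ (LinearMap.range (Polynomial.aeval (R := ℝ) c.U).toLinearMap ⊔
      LinearMap.range (Polynomial.aeval (R := ℝ) c.V).toLinearMap) ⊔ c.kerVanishing 0 L := by
    refine c.mem_of_generators (κ := 0) (fun i _ => ?_) (fun j _ => ?_) (fun r hr => ?_) hp
    · exact Submodule.mem_sup_left (Submodule.mem_sup_left ⟨Polynomial.X ^ i, by simp⟩)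
    · exact Submodule.mem_sup_left (Submodule.mem_sup_right ⟨Polynomial.X ^ j, by simp⟩)
    · refine Submodule.mem_sup_right (c.mem_kerVanishing.2 ⟨hL r hr, fun z hz => ?_⟩)
      rw [map_mul, c.ev_sub_of_mem_conic hz, zero_mul]
  obtain ⟨s, hs, k, hk, rfl⟩ := Submodule.mem_sup.1 hmem
  obtain ⟨_, ⟨f, rfl⟩, _, ⟨g, rfl⟩, rfl⟩ := Submodule.mem_sup.1 hs
  obtain ⟨hk0, hkz⟩ := c.mem_kerVanishing.1 hk
  have hfg : ∀ u v, u * v = 0 → f.eval u + g.eval v = 0 := by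
    intro u v huv
    have hz := c.pt_mem_conic.2 huv
    have := h _ hz
    rw [map_add, hkz _ hz, add_zero, map_add] at this
    rw [← c.ev_aeval_U u v f, ← c.ev_aeval_V u v g]
    exact this
  -- Vanishing on each axis separately makes `f` and `g` opposite constants.
  have hf : f = Polynomial.C (-g.eval 0) := Polynomial.funext fun u => by
    have := hfg u 0 (mul_zero u)
    rw [Polynomial.eval_C]; linarith
  have hg : g = Polynomial.C (g.eval 0) := Polynomial.funext fun v => by
    have h1 := hfg 0 v (zero_mul v)
    have h2 := hfg 0 0 (zero_mul 0)
    rw [Polynomial.eval_C]; linarith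
  rw [map_add, hk0, add_zero, hf, hg]
  simp

/-- The linear map from Laurent polynomials `∑ a_k t ^ (k - m)` to polynomials on the conic
`U V = 1`, where `t = U`. -/
noncomputable def lift (m : ℕ) : Polynomial ℝ →ₗ[ℝ] Poly :=
  (Polynomial.basisMonomials ℝ).constr ℝ fun k => c.U ^ (k - m) * c.V ^ (m - k)

theorem lift_X_pow (m k : ℕ) : c.lift m (Polynomial.X ^ k) = c.U ^ (k - m) * c.V ^ (m - k) := by
  rw [lift, Polynomial.X_pow_eq_monomial]
  exact Module.Basis.constr_basis (Polynomial.basisMonomials ℝ) ℝ _ _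

theorem lift_eq_sum (m : ℕ) (f : Polynomial ℝ) :
    c.lift m f =
      ∑ k ∈ Finset.range (f.natDegree + 1), f.coeff k • (c.U ^ (k - m) * c.V ^ (m - k)) := by
  conv_lhs => rw [f.as_sum_range_C_mul_X_pow]
  simp only [map_sum, ← Polynomial.smul_eq_C_mul, map_smul, lift_X_pow]

theorem totalDegree_lift_le {m : ℕ} {f : Polynomial ℝ} (hf : f.natDegree ≤ 2 * m) :
    (c.lift m f).totalDegree ≤ m := by
  rw [lift_eq_sum]
  refine totalDegree_finsetSum_le fun k hk => (totalDegree_smul_le _ _).trans ?_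
  rw [Finset.mem_range] at hk
  exact (c.totalDegree_monomial_le _ _).trans (by omega)

/-- Truncated subtraction makes at least one of the exponents `k - m`, `m - k` zero, so at `(t,
t⁻¹)` the lift of `X ^ k` is the Laurent monomial of exponent `k` minus `m`. Multiplying by `t ^ m`
clears the denominators. -/
theorem ev_lift {m : ℕ} {t : ℝ} (ht : t ≠ 0) (f : Polynomial ℝ) :
    ev (c.pt t t⁻¹) (c.lift m f) * t ^ m = f.eval t := by
  rw [lift_eq_sum, map_sum, Finset.sum_mul, Polynomial.eval_eq_sum_range]
  refine Finset.sum_congr rfl fun k _ => ?_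
  rw [map_smul, map_mul, map_pow, map_pow, c.ev_U, c.ev_V, smul_eq_mul, mul_assoc]
  congr 1
  rcases le_total k m with h | h
  · obtain ⟨d, rfl⟩ := Nat.exists_eq_add_of_le h
    rw [Nat.sub_eq_zero_of_le h, Nat.add_sub_cancel_left, pow_add, inv_pow]
    field_simp
  · obtain ⟨d, rfl⟩ := Nat.exists_eq_add_of_le h
    rw [Nat.sub_eq_zero_of_le h, Nat.add_sub_cancel_left, pow_add]
    ring

/-- On a hyperbola, a functional which vanishes on the multiples of the equation vanishes on
every polynomial which vanishes on the hyperbola. -/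
theorem apply_eq_zero_of_conic_one {m : ℕ} {L : Poly →ₗ[ℝ] ℝ}
    (hL : ∀ r : Poly, r.totalDegree + 2 ≤ m → L ((c.U * c.V - C 1) * r) = 0)
    {p : Poly} (hp : p.totalDegree ≤ m) (h : ∀ z ∈ c.conic 1, ev z p = 0) : L p = 0 := by
  have hmem : p ∈ LinearMap.range (c.lift m) ⊔ c.kerVanishing 1 L := by
    refine c.mem_of_generators (κ := 1) (fun i _ => ?_) (fun j hj => ?_) (fun r hr => ?_) hp
    · exact Submodule.mem_sup_left ⟨Polynomial.X ^ (m + i), by simp [lift_X_pow]⟩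
    · refine Submodule.mem_sup_left ⟨Polynomial.X ^ (m - j), ?_⟩
      rw [lift_X_pow, Nat.sub_sub_self hj, Nat.sub_eq_zero_of_le (Nat.sub_le m j), pow_zero,
        one_mul]
    · refine Submodule.mem_sup_right (c.mem_kerVanishing.2 ⟨hL r hr, fun z hz => ?_⟩)
      rw [map_mul, c.ev_sub_of_mem_conic hz, zero_mul]
  obtain ⟨_, ⟨f, rfl⟩, k, hk, rfl⟩ := Submodule.mem_sup.1 hmem
  obtain ⟨hk0, hkz⟩ := c.mem_kerVanishing.1 hk
  have hf : f = 0 := by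
    refine Polynomial.eq_zero_of_infinite_isRoot f
      ((Set.finite_singleton (0 : ℝ)).infinite_compl.mono fun t ht => ?_)
    have hz : c.pt t t⁻¹ ∈ c.conic 1 := c.pt_mem_conic.2 (mul_inv_cancel₀ ht)
    have := h _ hz
    rw [map_add, hkz _ hz, add_zero] at this
    change f.eval t = 0
    rw [← c.ev_lift (m := m) ht f, this, zero_mul]
  rw [map_add, hk0, hf, map_zero, map_zero, add_zero]

end Coords

/-! ### Atomic representations and the dichotomy on the rank -/

/-- A functional has a finite atomic representation on the polynomials of degree `≤ 2 n`. -/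
def IsAtomicRep (n : ℕ) (L : Poly →ₗ[ℝ] ℝ) (Z : Set (ℝ × ℝ)) (S : Finset (ℝ × ℝ))
    (ρ : ℝ × ℝ → ℝ) : Prop :=
  (∀ z ∈ S, 0 < ρ z) ∧ ↑S ⊆ Z ∧
    ∀ p : Poly, p.totalDegree ≤ 2 * n → L p = ∑ z ∈ S, ρ z * ev z p

theorem totalDegree_mul_le_two_mul {n : ℕ} {p q : Poly} (hp : p.totalDegree ≤ n)
    (hq : q.totalDegree ≤ n) : (p * q).totalDegree ≤ 2 * n :=
  (totalDegree_mul _ _).trans (by omega)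

/-- Cauchy–Schwarz for a semidefinite form: `t ↦ L ((p + t q) ^ 2)` has no constant term and stays
nonnegative, so its linear term vanishes. -/
theorem ker_of_apply_sq_eq_zero {n : ℕ} {L : Poly →ₗ[ℝ] ℝ}
    (hpsd : ∀ p : Poly, p.totalDegree ≤ n → 0 ≤ L (p ^ 2)) {p : Poly} (hp : p.totalDegree ≤ n)
    (h : L (p ^ 2) = 0) : Ker n L p := by
  refine ⟨hp, fun q hq => ?_⟩
  have key : ∀ t : ℝ, 0 ≤ 2 * t * L (p * q) + t ^ 2 * L (q ^ 2) := by
    intro t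
    have h1 := hpsd (p + t • q) ((totalDegree_add _ _).trans
      (max_le hp ((totalDegree_smul_le _ _).trans hq)))
    have h2 : (p + t • q) ^ 2 = p ^ 2 + ((2 * t) • (p * q) + (t ^ 2) • q ^ 2) := by
      simp only [smul_eq_C_mul, map_mul, map_pow]
      rw [show (C 2 : Poly) = 2 from map_ofNat C 2]
      ring
    rw [h2, map_add, map_add, h, map_smul, map_smul, zero_add] at h1
    exact h1
  have hq0 := hpsd q hq
  by_contra hne
  rcases hq0.eq_or_lt with h0 | h0
  · have := key (-L (p * q))
    rw [← h0] at this
    nlinarith [sq_pos_of_ne_zero hne]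
  · have := key (-L (p * q) / L (q ^ 2))
    have e : 2 * (-L (p * q) / L (q ^ 2)) * L (p * q) + (-L (p * q) / L (q ^ 2)) ^ 2 * L (q ^ 2)
        = -(L (p * q)) ^ 2 / L (q ^ 2) := by field_simp; ring
    rw [e] at this
    have h3 : 0 < (L (p * q)) ^ 2 / L (q ^ 2) := div_pos (sq_pos_of_ne_zero hne) h0
    rw [neg_div] at this
    linarith

/-- A functional vanishes on all polynomials of degree `≤ 2 n` which vanish on `Z`. -/
def SupportedOn (n : ℕ) (L : Poly →ₗ[ℝ] ℝ) (Z : Set (ℝ × ℝ)) : Prop :=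
  ∀ p : Poly, p.totalDegree ≤ 2 * n → (∀ z ∈ Z, ev z p = 0) → L p = 0

theorem SupportedOn.congr {n : ℕ} {L : Poly →ₗ[ℝ] ℝ} {Z : Set (ℝ × ℝ)} (h : SupportedOn n L Z)
    {p q : Poly} (hp : p.totalDegree ≤ 2 * n) (hq : q.totalDegree ≤ 2 * n)
    (hpq : ∀ z ∈ Z, ev z p = ev z q) : L p = L q := by
  rw [← sub_eq_zero, ← map_sub]
  refine h _ ((totalDegree_sub _ _).trans (max_le hp hq)) fun z hz => ?_
  rw [map_sub, hpq z hz, sub_self]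

theorem SupportedOn.ker {n : ℕ} {L : Poly →ₗ[ℝ] ℝ} {Z : Set (ℝ × ℝ)} (h : SupportedOn n L Z)
    {p : Poly} (hp : p.totalDegree ≤ n) (hz : ∀ z ∈ Z, ev z p = 0) : Ker n L p :=
  ⟨hp, fun q hq => h _ (totalDegree_mul_le_two_mul hp hq) fun z hzZ => by
    rw [map_mul, hz z hzZ, zero_mul]⟩

/-- A polynomial with `L (p ^ 2) = 0` is in the kernel and so vanishes on `S`. Hence the form is
strictly positive on functions on `S`, and `exists_weights` gives positive masses. -/
theorem exists_isAtomicRep {n : ℕ} {L : Poly →ₗ[ℝ] ℝ} {Z : Set (ℝ × ℝ)} {S : Finset (ℝ × ℝ)}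
    (hpsd : ∀ p : Poly, p.totalDegree ≤ n → 0 ≤ L (p ^ 2)) (hSZ : ↑S ⊆ Z) (hS : Interp n S)
    (hker : ∀ p : Poly, Ker n L p → ∀ z ∈ S, ev z p = 0) (hL : SupportedOn n L S) :
    ∃ ρ, IsAtomicRep n L Z S ρ := by
  classical
  obtain ⟨ρ, hρ, h⟩ := exists_weights ev L (restrictTotalDegree (Fin 2) ℝ n)
    (restrictTotalDegree (Fin 2) ℝ (2 * n))
    (fun a ha => by
      rw [mem_restrictTotalDegree] at ha ⊢
      rw [pow_two]; exact totalDegree_mul_le_two_mul ha ha) S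
    (fun z hz => by
      obtain ⟨p, hp, hpz⟩ := hS fun w => if w = z then 1 else 0
      refine ⟨p, (mem_restrictTotalDegree _ _ _).2 hp, by rw [hpz z hz, if_pos rfl],
        fun w hw hne => by rw [hpz w hw, if_neg hne]⟩)
    (fun a ha => hL a ((mem_restrictTotalDegree _ _ _).1 ha))
    (fun a ha ⟨z, hz, hne⟩ => by
      rw [mem_restrictTotalDegree] at ha
      refine (hpsd a ha).lt_of_ne' fun h0 => hne ?_
      exact hker a (ker_of_apply_sq_eq_zero hpsd ha h0) z hz)
  exact ⟨ρ, hρ, hSZ, fun p hp => h p ((mem_restrictTotalDegree _ _ _).2 hp)⟩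

theorem IsAtomicRep.ker_iff {n : ℕ} {L : Poly →ₗ[ℝ] ℝ} {Z : Set (ℝ × ℝ)} {S : Finset (ℝ × ℝ)}
    {ρ : ℝ × ℝ → ℝ} (h : IsAtomicRep n L Z S ρ) {p : Poly} (hp : p.totalDegree ≤ n) :
    Ker n L p ↔ ∀ z ∈ S, ev z p = 0 := by
  constructor
  · intro hk z hz
    have h1 := hk.2 p hp
    rw [h.2.2 _ (totalDegree_mul_le_two_mul hp hp)] at h1
    rw [Finset.sum_eq_zero_iff_of_nonneg (fun w hw => by
      rw [map_mul]; exact mul_nonneg (h.1 w hw).le (mul_self_nonneg _))] at h1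
    have h2 := h1 z hz
    rw [map_mul] at h2
    exact mul_self_eq_zero.1 ((mul_eq_zero.1 h2).resolve_left (h.1 z hz).ne')
  · intro hz
    refine ⟨hp, fun q hq => ?_⟩
    rw [h.2.2 _ (totalDegree_mul_le_two_mul hp hq)]
    exact Finset.sum_eq_zero fun z hzS => by rw [map_mul, hz z hzS, zero_mul, mul_zero]

theorem IsAtomicRep.rank_eq {n : ℕ} {β : ℕ → ℕ → ℝ} {Z : Set (ℝ × ℝ)} {S : Finset (ℝ × ℝ)}
    {ρ : ℝ × ℝ → ℝ} (h : IsAtomicRep n (riesz β) Z S ρ) (hS : Interp n S) :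
    (momentMatrix n β).rank = S.card :=
  le_antisymm (rank_le_card fun _ hp => (h.ker_iff hp).2)
    (card_le_rank hS fun _ hp => (h.ker_iff hp.1).1 hp)

/-- The conclusions of the main theorem, in terms of atomic representations. -/
def Solvable (n : ℕ) (β : ℕ → ℕ → ℝ) (Z : Set (ℝ × ℝ)) : Prop :=
  (momentMatrix n β).rank ≤ 2 * n + 1 ∧
    ((momentMatrix n β).rank ≤ 2 * n →
      ∃ S ρ, IsAtomicRep n (riesz β) Z S ρ ∧ Interp n S) ∧
    ((momentMatrix n β).rank = 2 * n + 1 →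
      ∃ S ρ, IsAtomicRep n (riesz β) Z S ρ ∧ S.card ≤ 2 * n + 2)

/-- The `2 n + 1` points of `S₀` determine restrictions to `Z` in degree at most `n`. A kernel
trivial on `Z` thus means rank `2 n + 1`, and any smaller rank supplies a kernel element that is not
zero on `Z`. This reduces the theorem to one existence statement per case. -/
theorem solvable_of_frame {n : ℕ} {β : ℕ → ℕ → ℝ} {Z : Set (ℝ × ℝ)} {S₀ : Finset (ℝ × ℝ)}
    (hL : SupportedOn n (riesz β) Z) (hcard : S₀.card = 2 * n + 1) (hS₀ : Interp n S₀)
    (hS₀Z : ↑S₀ ⊆ Z)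
    (h₀ : ∀ p : Poly, p.totalDegree ≤ n → (∀ z ∈ S₀, ev z p = 0) → ∀ z ∈ Z, ev z p = 0)
    (hsing : ∀ p : Poly, Ker n (riesz β) p → (∃ z ∈ Z, ev z p ≠ 0) →
      ∃ S ρ, IsAtomicRep n (riesz β) Z S ρ ∧ Interp n S)
    (hreg : (∀ p : Poly, Ker n (riesz β) p → ∀ z ∈ Z, ev z p = 0) →
      ∃ S ρ, IsAtomicRep n (riesz β) Z S ρ ∧ S.card ≤ 2 * n + 2) :
    Solvable n β Z := by
  have hk : ∀ p : Poly, p.totalDegree ≤ n → (∀ z ∈ S₀, ev z p = 0) → Ker n (riesz β) p :=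
    fun p hp hz => hL.ker hp (h₀ p hp hz)
  refine ⟨hcard ▸ rank_le_card hk, fun hr => ?_, fun hr => ?_⟩
  · by_cases h : ∃ p : Poly, Ker n (riesz β) p ∧ ∃ z ∈ Z, ev z p ≠ 0
    · obtain ⟨p, hp, hz⟩ := h
      exact hsing p hp hz
    · push Not at h
      have := card_le_rank hS₀ fun p hp z hz => h p hp z (hS₀Z hz)
      omega
  · refine hreg fun p hp => h₀ p hp.1 ?_
    exact eval_eq_zero_of_card_le_rank hk (by omega) p hp

theorem mem_momentVariety {n : ℕ} {β : ℕ → ℕ → ℝ} {z : ℝ × ℝ} :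
    z ∈ momentVariety n β ↔ ∀ p : Poly, Ker n (riesz β) p → ev z p = 0 := by
  simp only [momentVariety, Set.mem_iInter, mem_zeroSet]
  exact ⟨fun h p hp => h p hp.1 ((ker_iff_polyCol n β hp.1).1 hp),
    fun h p hp hk => h p ((ker_iff_polyCol n β hp).2 hk)⟩

/-- If the variety is finite and points of it are interpolation nodes, then the inequality between
the rank and the cardinality of the variety identifies the kernel. -/
theorem ker_of_rank_le_encard {n : ℕ} {β : ℕ → ℕ → ℝ} {S : Finset (ℝ × ℝ)}
    (hS : ↑S = momentVariety n β) (hSi : Interp n S)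
    (hr : ((momentMatrix n β).rank : ℕ∞) ≤ (momentVariety n β).encard) :
    ∀ p : Poly, p.totalDegree ≤ n → (∀ z ∈ S, ev z p = 0) → Ker n (riesz β) p := by
  refine ker_of_rank_le_card hSi (fun p hp z hz => ?_) ?_
  · exact mem_momentVariety.1 (hS ▸ Finset.mem_coe.2 hz) p hp
  · rw [← hS, Set.encard_coe_eq_coe_finsetCard] at hr
    exact_mod_cast hr

/-! ### Interpolation tools and the hyperbola `U V = 1` -/

theorem natDegree_interpolate_le {ι : Type*} [DecidableEq ι] {S : Finset ι} {v : ι → ℝ}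
    (hv : Set.InjOn v S) {k : ℕ} (hk : S.card ≤ k + 1) (r : ι → ℝ) :
    (Lagrange.interpolate S v r).natDegree ≤ k := by
  rw [← mem_degreeLT_succ, Polynomial.mem_degreeLT]
  exact (Lagrange.degree_interpolate_lt r hv).trans_le (by exact_mod_cast hk)

/-- A polynomial vanishing at the nodes is a multiple of the nodal polynomial. -/
theorem nodal_dvd {ι : Type*} {S : Finset ι} {v : ι → ℝ} (hv : Set.InjOn v S) {f : Polynomial ℝ}
    (hf : ∀ z ∈ S, f.eval (v z) = 0) : Lagrange.nodal S v ∣ f := by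
  rw [← Polynomial.modByMonic_eq_zero_iff_dvd Lagrange.nodal_monic]
  refine Polynomial.eq_zero_of_degree_lt_of_eval_index_eq_zero S hv ?_ fun z hz => ?_
  · rw [← Lagrange.degree_nodal (s := S) (v := v)]
    exact Polynomial.degree_modByMonic_lt _ Lagrange.nodal_monic
  · have h := congrArg (Polynomial.eval (v z))
      (Polynomial.modByMonic_add_div f (Lagrange.nodal S v))
    rwa [Polynomial.eval_add, Polynomial.eval_mul, Lagrange.eval_nodal_at_node hz, zero_mul,
      add_zero, hf z hz] at h

namespace Coords

variable (c : Coords)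

theorem ne_zero_of_mem_conic_one {z : ℝ × ℝ} (hz : z ∈ c.conic 1) : ev z c.U ≠ 0 := fun h => by
  have : ev z c.U * ev z c.V = 1 := hz
  rw [h, zero_mul] at this
  exact zero_ne_one this

theorem eq_pt_of_mem_conic_one {z : ℝ × ℝ} (hz : z ∈ c.conic 1) :
    z = c.pt (ev z c.U) (ev z c.U)⁻¹ := by
  rw [← eq_inv_of_mul_eq_one_right (show ev z c.U * ev z c.V = 1 from hz), c.pt_ev]

theorem injOn_conic_one : Set.InjOn (fun z => ev z c.U) (c.conic 1) := fun z hz w hw h => by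
  rw [c.eq_pt_of_mem_conic_one hz, c.eq_pt_of_mem_conic_one hw]
  simp only at h
  rw [h]

theorem ev_lift' {m : ℕ} {z : ℝ × ℝ} (hz : z ∈ c.conic 1) (f : Polynomial ℝ) :
    ev z (c.lift m f) * ev z c.U ^ m = f.eval (ev z c.U) := by
  conv_lhs => rw [c.eq_pt_of_mem_conic_one hz, c.ev_U]
  exact c.ev_lift (c.ne_zero_of_mem_conic_one hz) f

/-- On the hyperbola `V = U⁻¹`, so degree at most `m` means Laurent exponents between `-m` and `m`;
the factor `U ^ m` shifts them to `0, …, 2 m`. -/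
theorem exists_laurent {m : ℕ} {p : Poly} (hp : p.totalDegree ≤ m) :
    ∃ f : Polynomial ℝ, f.natDegree ≤ 2 * m ∧
      ∀ z ∈ c.conic 1, ev z p * ev z c.U ^ m = f.eval (ev z c.U) := by
  let T : Submodule ℝ Poly :=
    { carrier := {p | ∃ f : Polynomial ℝ, f.natDegree ≤ 2 * m ∧
        ∀ z ∈ c.conic 1, ev z p * ev z c.U ^ m = f.eval (ev z c.U)}
      zero_mem' := ⟨0, by simp, fun z _ => by simp⟩
      add_mem' := by
        rintro a b ⟨f, hf, hfz⟩ ⟨g, hg, hgz⟩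
        exact ⟨f + g, (Polynomial.natDegree_add_le _ _).trans (max_le hf hg), fun z hz => by
          rw [map_add, add_mul, hfz z hz, hgz z hz, Polynomial.eval_add]⟩
      smul_mem' := by
        rintro r a ⟨f, hf, hfz⟩
        exact ⟨r • f, (Polynomial.natDegree_smul_le _ _).trans hf, fun z hz => by
          rw [map_smul, smul_eq_mul, mul_assoc, hfz z hz, Polynomial.eval_smul, smul_eq_mul]⟩ }
  refine c.mem_of_monomials (T := T) (fun i j hij => ?_) hp
  refine ⟨Polynomial.X ^ (m + i - j), ?_, fun z hz => ?_⟩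
  · rw [Polynomial.natDegree_X_pow]; omega
  · have h1 : ev z c.U * ev z c.V = 1 := hz
    rw [map_mul, map_pow, map_pow, Polynomial.eval_pow, Polynomial.eval_X]
    obtain ⟨d, rfl⟩ : ∃ d, m = j + d := Nat.exists_eq_add_of_le (by omega)
    rw [show j + d + i - j = i + d by omega, pow_add, pow_add]
    have h2 : (ev z c.U) ^ j * (ev z c.V) ^ j = 1 := by rw [← mul_pow, h1, one_pow]
    linear_combination ((ev z c.U) ^ i * (ev z c.U) ^ d) * h2

theorem eq_lift_on_conic {m : ℕ} {p : Poly} {f : Polynomial ℝ}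
    (h : ∀ z ∈ c.conic 1, ev z p * ev z c.U ^ m = f.eval (ev z c.U)) :
    ∀ z ∈ c.conic 1, ev z p = ev z (c.lift m f) := fun z hz =>
  mul_right_cancel₀ (pow_ne_zero m (c.ne_zero_of_mem_conic_one hz))
    ((h z hz).trans (c.ev_lift' hz f).symm)

theorem interp_of_subset_conic_one {n : ℕ} {S : Finset (ℝ × ℝ)} (hS : ↑S ⊆ c.conic 1)
    (hcard : S.card ≤ 2 * n + 1) : Interp n S := by
  classical
  intro f
  have hv := c.injOn_conic_one.mono hS
  set g := Lagrange.interpolate S (fun z => ev z c.U) fun z => f z * ev z c.U ^ n with hg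
  have hgd : g.natDegree ≤ 2 * n := natDegree_interpolate_le hv hcard _
  refine ⟨c.lift n g, c.totalDegree_lift_le hgd, fun z hz => ?_⟩
  refine mul_right_cancel₀ (pow_ne_zero n (c.ne_zero_of_mem_conic_one (hS hz))) ?_
  rw [c.ev_lift' (hS hz), hg, Lagrange.eval_interpolate_at_node _ hv hz]

theorem vanish_of_vanish_on_card {n : ℕ} {S : Finset (ℝ × ℝ)} (hS : ↑S ⊆ c.conic 1)
    (hcard : 2 * n + 1 ≤ S.card) {p : Poly} (hp : p.totalDegree ≤ n)
    (h : ∀ z ∈ S, ev z p = 0) : ∀ z ∈ c.conic 1, ev z p = 0 := by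
  obtain ⟨f, hf, hfz⟩ := c.exists_laurent hp
  have hf0 : f = 0 := by
    refine Polynomial.eq_zero_of_degree_lt_of_eval_index_eq_zero S
      (c.injOn_conic_one.mono hS) ?_ fun z hz => ?_
    · refine Polynomial.degree_le_natDegree.trans_lt ?_
      exact_mod_cast (by omega : f.natDegree < S.card)
    · rw [← hfz z (hS hz), h z hz, zero_mul]
  intro z hz
  rw [c.eq_lift_on_conic hfz z hz, hf0, map_zero, map_zero]

variable {n : ℕ} {β : ℕ → ℕ → ℝ}

theorem riesz_lift_mul (hL : SupportedOn n (riesz β) (c.conic 1)) {f g : Polynomial ℝ}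
    (hf : f.natDegree ≤ 2 * n) (hg : g.natDegree ≤ 2 * n) :
    riesz β (c.lift (2 * n) (f * g)) = riesz β (c.lift n f * c.lift n g) := by
  refine hL.congr (c.totalDegree_lift_le (Polynomial.natDegree_mul_le.trans (by omega)))
    (totalDegree_mul_le_two_mul (c.totalDegree_lift_le hf) (c.totalDegree_lift_le hg))
    fun z hz => ?_
  refine mul_right_cancel₀ (pow_ne_zero (2 * n) (c.ne_zero_of_mem_conic_one hz)) ?_
  rw [c.ev_lift' hz, Polynomial.eval_mul, ← c.ev_lift' (m := n) hz, ← c.ev_lift' (m := n) hz,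
    map_mul]
  ring

/-- The main theorem on the hyperbola `U V = 1`. -/
theorem solvable_conic_one
    (hpsd : ∀ p : Poly, p.totalDegree ≤ n → 0 ≤ riesz β (p ^ 2))
    (hL : SupportedOn n (riesz β) (c.conic 1)) (hV : momentVariety n β ⊆ c.conic 1)
    (hr : ((momentMatrix n β).rank : ℕ∞) ≤ (momentVariety n β).encard) :
    Solvable n β (c.conic 1) := by
  classical
  have hpt : ∀ t : ℝ, t ≠ 0 → c.pt t t⁻¹ ∈ c.conic 1 := fun t ht =>
    c.pt_mem_conic.2 (mul_inv_cancel₀ ht)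
  have hptinj : Function.Injective fun t : ℝ => c.pt t t⁻¹ := fun s t h => by
    have := congrArg (fun z => ev z c.U) h
    simpa only [c.ev_U] using this
  set S₀ : Finset (ℝ × ℝ) :=
    (Finset.range (2 * n + 1)).image fun i : ℕ => c.pt ((i : ℝ) + 1) ((i : ℝ) + 1)⁻¹ with hS₀
  have hS₀c : S₀.card = 2 * n + 1 := by
    rw [hS₀, Finset.card_image_of_injective, Finset.card_range]
    intro i j hij
    have : (i : ℝ) + 1 = j + 1 := hptinj hij
    exact_mod_cast add_right_cancel this
  have hS₀Z : ↑S₀ ⊆ c.conic 1 := by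
    intro z hz
    obtain ⟨i, _, rfl⟩ := Finset.mem_image.1 (Finset.mem_coe.1 hz)
    exact hpt _ (by positivity)
  refine solvable_of_frame hL hS₀c (c.interp_of_subset_conic_one hS₀Z hS₀c.le) hS₀Z
    (fun p hp => c.vanish_of_vanish_on_card hS₀Z hS₀c.ge hp) (fun p hp hz => ?_) (fun hreg => ?_)
  -- Singular case: a kernel element not zero on the hyperbola has at most `2 n` zeros there, so the
  -- variety is finite and will carry the atoms.
  · have hsub : ∀ S : Finset (ℝ × ℝ), ↑S ⊆ momentVariety n β → S.card ≤ 2 * n := by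
      intro S hS
      by_contra! hlt
      obtain ⟨z, hz, hne⟩ := hz
      exact hne (c.vanish_of_vanish_on_card (hS.trans hV) hlt hp.1
        (fun w hw => mem_momentVariety.1 (hS hw) p hp) z hz)
    have hfin : (momentVariety n β).Finite := by
      by_contra hinf
      obtain ⟨S, hS, hcard⟩ := Set.Infinite.exists_subset_card_eq hinf (2 * n + 1)
      have := hsub S hS
      omega
    obtain ⟨S, hS⟩ := hfin.exists_finset_coe
    have hSc := hsub S hS.le
    have hSZ : ↑S ⊆ c.conic 1 := hS ▸ hV
    have hSi := c.interp_of_subset_conic_one (n := n) hSZ (by omega)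
    have hSk := ker_of_rank_le_encard hS hSi hr
    suffices hSL : SupportedOn n (riesz β) S by
      obtain ⟨ρ, hρ⟩ := exists_isAtomicRep hpsd hSZ hSi
        (fun q hq z hz => mem_momentVariety.1 (hS ▸ Finset.mem_coe.2 hz) q hq) hSL
      exact ⟨S, ρ, hρ, hSi⟩
    intro q hq hqz
    obtain ⟨f, hf, hfz⟩ := c.exists_laurent hq
    have hv := c.injOn_conic_one.mono hSZ
    obtain ⟨g, rfl⟩ := nodal_dvd hv (f := f) fun z hz => by
      rw [← hfz z (hSZ hz), hqz z hz, zero_mul]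
    rw [hL.congr hq (c.totalDegree_lift_le hf) (c.eq_lift_on_conic hfz)]
    set h := Lagrange.nodal S (fun z => ev z c.U) with hh
    have hhd : h.natDegree = S.card := Lagrange.natDegree_nodal
    have hh0 : h ≠ 0 := Lagrange.nodal_ne_zero
    rcases eq_or_ne g 0 with rfl | hg0
    · simp
    rw [Polynomial.natDegree_mul hh0 hg0, hhd] at hf
    rw [g.as_sum_range_C_mul_X_pow, Finset.mul_sum, map_sum, map_sum]
    refine Finset.sum_eq_zero fun k hk => ?_
    rw [Finset.mem_range] at hk
    rw [← Polynomial.smul_eq_C_mul, mul_smul_comm, map_smul, map_smul]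
    -- Take `i = min k (2 * n - S.card)`. Then `h * X ^ i` still lifts to degree at most `n` and
    -- vanishes on `S`, so it lies in the kernel; the remaining `X ^ j` lifts to a legitimate test
    -- polynomial.
    obtain ⟨i, j, hi, hj, rfl⟩ : ∃ i j, S.card + i ≤ 2 * n ∧ j ≤ 2 * n ∧ k = i + j :=
      ⟨k - (k - (2 * n - S.card)), k - (2 * n - S.card), by omega, by omega, by omega⟩
    have hd : (h * Polynomial.X ^ i).natDegree ≤ 2 * n := by
      refine Polynomial.natDegree_mul_le.trans ?_
      rw [hhd, Polynomial.natDegree_X_pow]; exact hi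
    rw [pow_add, ← mul_assoc, c.riesz_lift_mul hL hd (by rw [Polynomial.natDegree_X_pow]; exact hj)]
    rw [(hSk (c.lift n (h * Polynomial.X ^ i)) (c.totalDegree_lift_le hd) fun z hz => ?_).2 _
      (c.totalDegree_lift_le (by rw [Polynomial.natDegree_X_pow]; exact hj)), smul_zero]
    refine mul_right_cancel₀ (pow_ne_zero n (c.ne_zero_of_mem_conic_one (hSZ hz))) ?_
    rw [c.ev_lift' (hSZ hz), Polynomial.eval_mul, hh,
      Lagrange.eval_nodal_at_node (v := fun z => ev z c.U) hz, zero_mul, zero_mul]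
  -- Regular case: polynomials of degree at most `2 n` on the hyperbola become one-variable
  -- polynomials of degree at most `4 n`, so `2 n + 1` nodes suffice. The nonzero even powers `t ^
  -- (2 * n)`, restoring the cleared denominators, keep the weights positive.
  · obtain ⟨S, ρ, hSc, hS0, hρ, hS⟩ := exists_gauss (riesz β ∘ₗ c.lift (2 * n)) (2 * n)
      (fun q hq hqd => by
        rw [LinearMap.comp_apply, pow_two, c.riesz_lift_mul hL hqd hqd, ← pow_two]
        refine (hpsd _ (c.totalDegree_lift_le hqd)).lt_of_ne' fun h0 => hq ?_
        have hk := hreg _ (ker_of_apply_sq_eq_zero hpsd (c.totalDegree_lift_le hqd) h0)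
        refine Polynomial.eq_zero_of_infinite_isRoot q
          ((Set.finite_singleton (0 : ℝ)).infinite_compl.mono fun t ht => ?_)
        change q.eval t = 0
        rw [← c.ev_lift (m := n) ht q, hk _ (hpt t ht), zero_mul])
    have hne : ∀ t ∈ S, t ≠ 0 := fun t ht h => hS0 (h ▸ ht)
    refine ⟨S.image fun t => c.pt t t⁻¹, fun z => ρ (ev z c.U) * ev z c.U ^ (2 * n),
      ⟨?_, ?_, fun p hp => ?_⟩, ?_⟩
    · intro z hz
      obtain ⟨t, ht, rfl⟩ := Finset.mem_image.1 hz
      simp only [c.ev_U]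
      exact mul_pos (hρ t ht) ((even_two_mul n).pow_pos (hne t ht))
    · intro z hz
      obtain ⟨t, ht, rfl⟩ := Finset.mem_image.1 (Finset.mem_coe.1 hz)
      exact hpt t (hne t ht)
    · obtain ⟨f, hf, hfz⟩ := c.exists_laurent hp
      rw [hL.congr hp (c.totalDegree_lift_le hf) (c.eq_lift_on_conic hfz)]
      rw [Finset.sum_image fun s _ t _ h => hptinj h]
      refine (hS f hf).trans (Finset.sum_congr rfl fun t ht => ?_)
      have := hfz _ (hpt t (hne t ht))
      simp only [c.ev_U] at this ⊢
      rw [← this]; ring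
    · exact Finset.card_image_le.trans (by omega)

end Coords

/-! ### The pair of lines `U V = 0` -/

/-- The functional `Λ` with the mass `w` at `0` removed. -/
noncomputable def dropMass (Λ : Polynomial ℝ →ₗ[ℝ] ℝ) (w : ℝ) : Polynomial ℝ →ₗ[ℝ] ℝ :=
  Λ - w • (Polynomial.leval (0 : ℝ) : Polynomial ℝ →ₗ[ℝ] ℝ)

theorem dropMass_apply (Λ : Polynomial ℝ →ₗ[ℝ] ℝ) (w : ℝ) (f : Polynomial ℝ) :
    dropMass Λ w f = Λ f - w * f.eval 0 := rfl

/-- Splitting off the minimal mass at `0`: if a functional is positive on the squares of the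
polynomials vanishing at `0`, then removing any mass smaller than `Λ (f ^ 2)` at `0` leaves it
positive definite, for a suitable `f` with `f 0 = 1`. -/
theorem exists_minimal_mass (Λ : Polynomial ℝ →ₗ[ℝ] ℝ) (N : ℕ)
    (hpos : ∀ q : Polynomial ℝ, q ≠ 0 → q.natDegree ≤ N → 0 < Λ ((Polynomial.X * q) ^ 2)) :
    ∃ f : Polynomial ℝ, f.natDegree ≤ N + 1 ∧ f.eval 0 = 1 ∧ ∀ w < Λ (f ^ 2),
      ∀ q : Polynomial ℝ, q ≠ 0 → q.natDegree ≤ N + 1 →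
        0 < dropMass Λ w (q ^ 2) := by
  -- Projecting `1` onto the multiples of `X`: the residue `1 - X * k` is orthogonal to them and
  -- minimizes `Λ (f ^ 2)` under `f 0 = 1`.
  obtain ⟨k, hkd, hk⟩ := exists_riesz (Λ ∘ₗ LinearMap.mulLeft ℝ (Polynomial.X ^ 2)) N
    (fun q hq hqd => by
      have := hpos q hq hqd
      rw [mul_pow] at this
      exact this) (Λ ∘ₗ LinearMap.mulLeft ℝ Polynomial.X)
  have hXk : (Polynomial.X * k).natDegree ≤ N + 1 :=
    Polynomial.natDegree_mul_le.trans (by rw [Polynomial.natDegree_X]; omega)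
  set f : Polynomial ℝ := 1 - Polynomial.X * k with hf
  have hfd : f.natDegree ≤ N + 1 :=
    (Polynomial.natDegree_sub_le _ _).trans (max_le (by simp) hXk)
  have hf0 : f.eval 0 = 1 := by simp [hf]
  have hort : ∀ q : Polynomial ℝ, q.natDegree ≤ N → Λ (f * (Polynomial.X * q)) = 0 := by
    intro q hq
    have := hk q hq
    simp only [LinearMap.comp_apply, LinearMap.mulLeft_apply] at this
    rw [hf, sub_mul, one_mul, map_sub, ← this, sub_eq_zero]
    congr 1; ring
  refine ⟨f, hfd, hf0, fun w hw q hq hqd => ?_⟩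
  have hr0 : (q - Polynomial.C (q.eval 0) * f).coeff 0 = 0 := by
    rw [Polynomial.coeff_zero_eq_eval_zero, Polynomial.eval_sub, Polynomial.eval_mul,
      Polynomial.eval_C, hf0, mul_one, sub_self]
  obtain ⟨r, hr⟩ := Polynomial.X_dvd_iff.2 hr0
  have hrd : r.natDegree ≤ N := by
    rcases eq_or_ne r 0 with rfl | h0
    · simp
    have h1 : (Polynomial.X * r).natDegree ≤ N + 1 := by
      rw [← hr]
      exact (Polynomial.natDegree_sub_le _ _).trans
        (max_le hqd ((Polynomial.natDegree_C_mul_le _ _).trans hfd))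
    rw [Polynomial.natDegree_X_mul h0] at h1
    omega
  -- Pythagoras for `q = q 0 • f + X * r`; the cross term dies under `Λ`.
  have hqe : q ^ 2 = (q.eval 0) ^ 2 • f ^ 2 + ((2 * q.eval 0) • (f * (Polynomial.X * r))
      + (Polynomial.X * r) ^ 2) := by
    have : q = Polynomial.C (q.eval 0) * f + Polynomial.X * r := by rw [← hr]; ring
    conv_lhs => rw [this]
    simp only [Polynomial.smul_eq_C_mul, map_mul, map_pow, Polynomial.C_ofNat]
    ring
  have hval : dropMass Λ w (q ^ 2) =
      (q.eval 0) ^ 2 * (Λ (f ^ 2) - w) + Λ ((Polynomial.X * r) ^ 2) := by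
    rw [dropMass_apply, Polynomial.eval_pow, hqe, map_add, map_add, map_smul,
      map_smul, hort r hrd, smul_zero, zero_add,
      smul_eq_mul]
    ring
  rw [hval]
  rcases eq_or_ne r 0 with rfl | h0
  · have : q.eval 0 ≠ 0 := by
      intro h
      rw [h, Polynomial.C_0, zero_mul, sub_zero, mul_zero] at hr
      exact hq hr
    have h2 : 0 < (q.eval 0) ^ 2 := by positivity
    have h3 := mul_pos h2 (sub_pos.2 hw)
    simpa using h3
  · exact add_pos_of_nonneg_of_pos (mul_nonneg (sq_nonneg _) (sub_pos.2 hw).le) (hpos r h0 hrd)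

theorem Ker.congr {n : ℕ} {L : Poly →ₗ[ℝ] ℝ} {Z : Set (ℝ × ℝ)} (hL : SupportedOn n L Z)
    {p q : Poly} (hp : Ker n L p) (hq : q.totalDegree ≤ n) (h : ∀ z ∈ Z, ev z p = ev z q) :
    Ker n L q :=
  ⟨hq, fun r hr => by
    rw [← hp.2 r hr]
    exact hL.congr (totalDegree_mul_le_two_mul hq hr) (totalDegree_mul_le_two_mul hp.1 hr)
      fun z hz => by rw [map_mul, map_mul, h z hz]⟩

namespace Coords

variable (c : Coords)

theorem swap_conic (κ : ℝ) : c.swap.conic κ = c.conic κ := by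
  ext z
  exact Eq.congr_left (mul_comm _ _)

theorem forall_conic_zero {φ : ℝ × ℝ → Prop} (hU : ∀ u, φ (c.pt u 0)) (hV : ∀ v, φ (c.pt 0 v)) :
    ∀ z ∈ c.conic 0, φ z := by
  intro z hz
  rw [← c.pt_ev z]
  rcases mul_eq_zero.1 hz with h | h
  · rw [h]; exact hV _
  · rw [h]; exact hU _

theorem pt_left_mem (u : ℝ) : c.pt u 0 ∈ c.conic 0 := c.pt_mem_conic.2 (mul_zero u)

theorem pt_right_mem (v : ℝ) : c.pt 0 v ∈ c.conic 0 := c.pt_mem_conic.2 (zero_mul v)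

/-- The restriction of a polynomial to the axis `V = 0`. -/
theorem exists_restrict {m : ℕ} {p : Poly} (hp : p.totalDegree ≤ m) :
    ∃ f : Polynomial ℝ, f.natDegree ≤ m ∧ ∀ u, ev (c.pt u 0) p = f.eval u := by
  let T : Submodule ℝ Poly :=
    { carrier := {p | ∃ f : Polynomial ℝ, f.natDegree ≤ m ∧ ∀ u, ev (c.pt u 0) p = f.eval u}
      zero_mem' := ⟨0, by simp, fun z => by simp⟩
      add_mem' := by
        rintro a b ⟨f, hf, hfz⟩ ⟨g, hg, hgz⟩
        exact ⟨f + g, (Polynomial.natDegree_add_le _ _).trans (max_le hf hg), fun z => by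
          rw [map_add, hfz z, hgz z, Polynomial.eval_add]⟩
      smul_mem' := by
        rintro r a ⟨f, hf, hfz⟩
        exact ⟨r • f, (Polynomial.natDegree_smul_le _ _).trans hf, fun z => by
          rw [map_smul, hfz z, Polynomial.eval_smul]⟩ }
  refine c.mem_of_monomials (T := T) (fun i j hij => ?_) hp
  -- Only monomials with `j = 0` survive on the axis, encoded by `0 ^ 0 = 1`.
  refine ⟨(0 : ℝ) ^ j • Polynomial.X ^ i, ?_, fun u => ?_⟩
  · refine (Polynomial.natDegree_smul_le _ _).trans ?_
    rw [Polynomial.natDegree_X_pow]; omega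
  · simp [c.ev_U, c.ev_V, mul_comm]

/-- The polynomial with restrictions `f` and `g` to the axes, if `f 0 = g 0`. -/
noncomputable def glue (f g : Polynomial ℝ) : Poly :=
  Polynomial.aeval c.U f + Polynomial.aeval c.V g - C (g.eval 0)

theorem ev_C (z : ℝ × ℝ) (r : ℝ) : ev z (C r) = r := by
  rw [← algebraMap_eq, AlgHom.commutes]; rfl

theorem ev_glue_left (f g : Polynomial ℝ) (u : ℝ) : ev (c.pt u 0) (c.glue f g) = f.eval u := by
  rw [glue, map_sub, map_add, ev_aeval_U, ev_aeval_V, ev_C]; ring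

theorem ev_glue_right {f g : Polynomial ℝ} (h : f.eval 0 = g.eval 0) (v : ℝ) :
    ev (c.pt 0 v) (c.glue f g) = g.eval v := by
  rw [glue, map_sub, map_add, ev_aeval_U, ev_aeval_V, ev_C, h]; ring

theorem totalDegree_glue_le {m : ℕ} {f g : Polynomial ℝ} (hf : f.natDegree ≤ m)
    (hg : g.natDegree ≤ m) : (c.glue f g).totalDegree ≤ m := by
  refine (totalDegree_sub _ _).trans (max_le ((totalDegree_add _ _).trans
    (max_le (c.totalDegree_aeval_U_le hf) (c.totalDegree_aeval_V_le hg))) ?_)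
  rw [totalDegree_C]; exact Nat.zero_le _

/-- The restriction of a functional to the polynomials in the first coordinate. -/
noncomputable def axis (L : Poly →ₗ[ℝ] ℝ) : Polynomial ℝ →ₗ[ℝ] ℝ :=
  L ∘ₗ (Polynomial.aeval c.U).toLinearMap

theorem axis_apply (L : Poly →ₗ[ℝ] ℝ) (f : Polynomial ℝ) :
    c.axis L f = L (Polynomial.aeval c.U f) := rfl

/-- The crossing point is counted on both axes; the last term removes the double count. Distributing
`L 1` between the axes is the crux of the case of two lines. -/
theorem apply_glue (L : Poly →ₗ[ℝ] ℝ) (f g : Polynomial ℝ) :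
    L (c.glue f g) = c.axis L f + c.swap.axis L g - g.eval 0 * L 1 := by
  rw [glue, map_sub, map_add, ← mul_one (C _), ← smul_eq_C_mul, map_smul]
  rfl

variable {n : ℕ} {L : Poly →ₗ[ℝ] ℝ}

theorem apply_eq_apply_glue (hL : SupportedOn n L (c.conic 0)) {p : Poly} {f g : Polynomial ℝ}
    (hp : p.totalDegree ≤ 2 * n) (hf : f.natDegree ≤ 2 * n) (hg : g.natDegree ≤ 2 * n)
    (hpf : ∀ u, ev (c.pt u 0) p = f.eval u) (hpg : ∀ v, ev (c.pt 0 v) p = g.eval v) :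
    L p = L (c.glue f g) := by
  refine hL.congr hp (c.totalDegree_glue_le hf hg) (c.forall_conic_zero (fun u => ?_) fun v => ?_)
  · rw [hpf, c.ev_glue_left]
  · rw [hpg, c.ev_glue_right (by rw [← hpf, ← hpg])]

theorem apply_glue_sq (hL : SupportedOn n L (c.conic 0)) {f g : Polynomial ℝ}
    (hf : f.natDegree ≤ n) (hg : g.natDegree ≤ n) (h : f.eval 0 = g.eval 0) :
    L (c.glue f g ^ 2) = c.axis L (f ^ 2) + c.swap.axis L (g ^ 2) - (g.eval 0) ^ 2 * L 1 := by
  have hsq : ∀ q : Polynomial ℝ, q.natDegree ≤ n → (q ^ 2).natDegree ≤ 2 * n := fun q hq =>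
    Polynomial.natDegree_pow_le.trans (by omega)
  rw [c.apply_eq_apply_glue hL (f := f ^ 2) (g := g ^ 2) _ (hsq f hf) (hsq g hg), c.apply_glue,
    Polynomial.eval_pow]
  · intro u
    rw [map_pow, c.ev_glue_left, Polynomial.eval_pow]
  · intro v
    rw [map_pow, c.ev_glue_right h, Polynomial.eval_pow]
  · rw [pow_two]
    exact totalDegree_mul_le_two_mul (c.totalDegree_glue_le hf hg) (c.totalDegree_glue_le hf hg)

theorem injOn_left : Set.InjOn (fun z => ev z c.U) {z | ev z c.V = 0} := fun _ hz _ hw h =>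
  c.ext_iff'.2 ⟨h, Eq.trans hz (Eq.symm hw)⟩

/-- One axis takes `n + 1` values freely. The other polynomial must then agree with the first at the
origin, which costs one degree of freedom and leaves room for `n` points. -/
theorem interp_of_subset_conic_zero (hn : 1 ≤ n) {S : Finset (ℝ × ℝ)} (hS : ↑S ⊆ c.conic 0)
    (h₁ : (S.filter fun z => ev z c.V = 0).card ≤ n + 1)
    (h₂ : (S.filter fun z => ev z c.V ≠ 0).card ≤ n) : Interp n S := by
  classical
  intro φ
  set S₁ := S.filter fun z => ev z c.V = 0 with hS₁
  set S₂ := S.filter fun z => ev z c.V ≠ 0 with hS₂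
  have hv₁ : Set.InjOn (fun z => ev z c.U) S₁ := c.injOn_left.mono fun z hz =>
    (Finset.mem_filter.1 (Finset.mem_coe.1 hz)).2
  have hu : ∀ z ∈ S, ev z c.V ≠ 0 → ev z c.U = 0 := fun z hz h =>
    (mul_eq_zero.1 (hS hz)).resolve_right h
  have hv₂ : Set.InjOn (fun z => ev z c.V) S₂ := c.swap.injOn_left.mono fun z hz =>
    hu z (Finset.mem_filter.1 hz).1 (Finset.mem_filter.1 hz).2
  set f := Lagrange.interpolate S₁ (fun z => ev z c.U) φ with hf
  set r := Lagrange.interpolate S₂ (fun z => ev z c.V)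
    (fun z => (φ z - f.eval 0) / ev z c.V) with hr
  have hfd : f.natDegree ≤ n := natDegree_interpolate_le hv₁ h₁ _
  have hrd : r.natDegree ≤ n - 1 := natDegree_interpolate_le hv₂ (by omega) _
  set g : Polynomial ℝ := Polynomial.C (f.eval 0) + Polynomial.X * r with hg
  have hgd : g.natDegree ≤ n := by
    refine (Polynomial.natDegree_add_le _ _).trans (max_le (by simp)
      (Polynomial.natDegree_mul_le.trans ?_))
    rw [Polynomial.natDegree_X]; omega
  have h0 : f.eval 0 = g.eval 0 := by simp [hg]
  refine ⟨c.glue f g, c.totalDegree_glue_le hfd hgd, fun z hz => ?_⟩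
  rw [← c.pt_ev z]
  by_cases hz0 : ev z c.V = 0
  · rw [hz0, c.ev_glue_left, ← hz0, c.pt_ev]
    exact Lagrange.eval_interpolate_at_node (v := fun z => ev z c.U) φ hv₁
      (Finset.mem_filter.2 ⟨hz, hz0⟩)
  · rw [hu z hz hz0, c.ev_glue_right h0, ← hu z hz hz0, c.pt_ev, hg, Polynomial.eval_add,
      Polynomial.eval_mul, Polynomial.eval_C, Polynomial.eval_X, hr,
      Lagrange.eval_interpolate_at_node (v := fun z => ev z c.V) _ hv₂
      (Finset.mem_filter.2 ⟨hz, hz0⟩)]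
    field_simp
    ring

/-- Quadrature formulas on the two axes combine to an atomic representation. -/
theorem exists_isAtomicRep_of_axes (hn : 1 ≤ n) (hL : SupportedOn n L (c.conic 0))
    {S₁ S₂ : Finset ℝ}
    {ρ₁ ρ₂ : ℝ → ℝ} (h0 : 0 ∉ S₂) (hρ₁ : ∀ t ∈ S₁, 0 < ρ₁ t) (hρ₂ : ∀ t ∈ S₂, 0 < ρ₂ t)
    (h : ∀ f g : Polynomial ℝ, f.natDegree ≤ 2 * n → g.natDegree ≤ 2 * n →
      f.eval 0 = g.eval 0 →
      L (c.glue f g) = ∑ t ∈ S₁, ρ₁ t * f.eval t + ∑ t ∈ S₂, ρ₂ t * g.eval t) :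
    ∃ S ρ, IsAtomicRep n L (c.conic 0) S ρ ∧ S.card ≤ S₁.card + S₂.card ∧
      (S₁.card ≤ n + 1 → S₂.card ≤ n → Interp n S) := by
  classical
  set A₁ := S₁.image fun t => c.pt t 0 with hA₁
  set A₂ := S₂.image fun t => c.pt 0 t with hA₂
  have hV₁ : ∀ z ∈ A₁, ev z c.V = 0 := by
    intro z hz
    obtain ⟨t, _, rfl⟩ := Finset.mem_image.1 hz
    exact c.ev_V t 0
  have hV₂ : ∀ z ∈ A₂, ev z c.V ≠ 0 := by
    intro z hz
    obtain ⟨t, ht, rfl⟩ := Finset.mem_image.1 hz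
    rw [c.ev_V]
    exact fun h => h0 (h ▸ ht)
  have hdisj : Disjoint A₁ A₂ := Finset.disjoint_left.2 fun z h₁ h₂ => hV₂ z h₂ (hV₁ z h₁)
  have hsub : ↑(A₁ ∪ A₂) ⊆ c.conic 0 := by
    intro z hz
    rcases Finset.mem_union.1 (Finset.mem_coe.1 hz) with hz | hz
    · obtain ⟨t, _, rfl⟩ := Finset.mem_image.1 hz
      exact c.pt_left_mem t
    · obtain ⟨t, _, rfl⟩ := Finset.mem_image.1 hz
      exact c.pt_right_mem t
  refine ⟨A₁ ∪ A₂, fun z => if ev z c.V = 0 then ρ₁ (ev z c.U) else ρ₂ (ev z c.V),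
    ⟨fun z hz => ?_, hsub, fun p hp => ?_⟩, ?_, fun hc₁ hc₂ => ?_⟩
  · rcases Finset.mem_union.1 hz with hz | hz
    · beta_reduce
      rw [if_pos (hV₁ z hz)]
      obtain ⟨t, ht, rfl⟩ := Finset.mem_image.1 hz
      rw [c.ev_U]
      exact hρ₁ t ht
    · beta_reduce
      rw [if_neg (hV₂ z hz)]
      obtain ⟨t, ht, rfl⟩ := Finset.mem_image.1 hz
      rw [c.ev_V]
      exact hρ₂ t ht
  · obtain ⟨f, hf, hpf⟩ := c.exists_restrict hp
    obtain ⟨g, hg, hpg⟩ := c.swap.exists_restrict hp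
    rw [c.apply_eq_apply_glue hL hp hf hg hpf hpg, h f g hf hg (by rw [← hpf, ← hpg]; rfl),
      Finset.sum_union hdisj, Finset.sum_image fun s _ t _ hst => ?_,
      Finset.sum_image fun s _ t _ hst => ?_]
    · congr 1
      · refine Finset.sum_congr rfl fun t ht => ?_
        beta_reduce
        rw [if_pos (c.ev_V t 0), c.ev_U, hpf]
      · refine Finset.sum_congr rfl fun t ht => ?_
        beta_reduce
        rw [if_neg (hV₂ _ (Finset.mem_image_of_mem _ ht)), c.ev_V]
        congr 1
        exact (hpg t).symm
    · rw [← c.ev_V 0 s, ← c.ev_V 0 t]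
      exact congrArg (fun z => ev z c.V) hst
    · rw [← c.ev_U s 0, ← c.ev_U t 0]
      exact congrArg (fun z => ev z c.U) hst
  · exact (Finset.card_union_le _ _).trans
      (add_le_add Finset.card_image_le Finset.card_image_le)
  · have hf₁ : (A₁ ∪ A₂).filter (fun z => ev z c.V = 0) ⊆ A₁ := fun z hz => by
      rw [Finset.mem_filter, Finset.mem_union] at hz
      exact hz.1.resolve_right fun h => hV₂ z h hz.2
    have hf₂ : (A₁ ∪ A₂).filter (fun z => ev z c.V ≠ 0) ⊆ A₂ := fun z hz => by
      rw [Finset.mem_filter, Finset.mem_union] at hz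
      exact hz.1.resolve_left fun h => hz.2 (hV₁ z h)
    exact c.interp_of_subset_conic_zero hn hsub
      ((Finset.card_le_card hf₁).trans (Finset.card_image_le.trans hc₁))
      ((Finset.card_le_card hf₂).trans (Finset.card_image_le.trans hc₂))

/-- Glue the two minimizers of `exists_minimal_mass`. The square of the result has value `δ`, the
sum of the two minimal values minus `L 1`, and definiteness gives `δ > 0`. -/
theorem exists_rep_of_regular (hn : 1 ≤ n)
    (hpsd : ∀ p : Poly, p.totalDegree ≤ n → 0 ≤ L (p ^ 2)) (hL : SupportedOn n L (c.conic 0))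
    (hreg : ∀ p : Poly, Ker n L p → ∀ z ∈ c.conic 0, ev z p = 0) :
    ∃ S ρ, IsAtomicRep n L (c.conic 0) S ρ ∧ S.card ≤ 2 * n + 2 := by
  have hpd : ∀ f g : Polynomial ℝ, f.natDegree ≤ n → g.natDegree ≤ n → f.eval 0 = g.eval 0 →
      (f ≠ 0 ∨ g ≠ 0) → 0 < L (c.glue f g ^ 2) := by
    intro f g hf hg h0 hne
    refine (hpsd _ (c.totalDegree_glue_le hf hg)).lt_of_ne' fun hz => ?_
    have hk := hreg _ (ker_of_apply_sq_eq_zero hpsd (c.totalDegree_glue_le hf hg) hz)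
    rcases hne with hne | hne
    · exact hne (Polynomial.funext fun u => by
        rw [← c.ev_glue_left f g, hk _ (c.pt_left_mem u), Polynomial.eval_zero])
    · exact hne (Polynomial.funext fun v => by
        rw [← c.ev_glue_right h0, hk _ (c.pt_right_mem v), Polynomial.eval_zero])
  have hX : ∀ q : Polynomial ℝ, q.natDegree ≤ n - 1 → (Polynomial.X * q).natDegree ≤ n :=
    fun q hq => Polynomial.natDegree_mul_le.trans (by rw [Polynomial.natDegree_X]; omega)
  obtain ⟨f, hfd, hf0, hf⟩ := exists_minimal_mass (c.axis L) (n - 1) fun q hq hqd => by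
    have h1 := hpd (Polynomial.X * q) 0 (hX q hqd) (by simp) (by simp)
      (Or.inl (mul_ne_zero Polynomial.X_ne_zero hq))
    rw [c.apply_glue_sq hL (hX q hqd) (by simp) (by simp)] at h1
    simpa using h1
  obtain ⟨g, hgd, hg0, hg⟩ := exists_minimal_mass (c.swap.axis L) (n - 1) fun q hq hqd => by
    have h1 := hpd 0 (Polynomial.X * q) (by simp) (hX q hqd) (by simp)
      (Or.inr (mul_ne_zero Polynomial.X_ne_zero hq))
    rw [c.apply_glue_sq hL (by simp) (hX q hqd) (by simp)] at h1
    simpa using h1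
  rw [Nat.sub_add_cancel hn] at hfd hf hgd hg
  have hδ := hpd f g hfd hgd (by rw [hf0, hg0]) (Or.inl fun h => by simp [h] at hf0)
  rw [c.apply_glue_sq hL hfd hgd (by rw [hf0, hg0]), hg0, one_pow, one_mul] at hδ
  set δ := c.axis L (f ^ 2) + c.swap.axis L (g ^ 2) - L 1 with hδd
  -- Each axis gives up its critical value less `δ / 2`. Both stay positive definite, and the two
  -- removed masses add up to `L 1`, exactly the double count.
  obtain ⟨S₁, ρ₁, hc₁, _, hρ₁, hS₁⟩ := exists_gauss _ n (hf (c.axis L (f ^ 2) - δ / 2) (by linarith))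
  obtain ⟨S₂, ρ₂, hc₂, h0, hρ₂, hS₂⟩ :=
    exists_gauss _ n (hg (c.swap.axis L (g ^ 2) - δ / 2) (by linarith))
  obtain ⟨S, ρ, hS, hcard, _⟩ := c.exists_isAtomicRep_of_axes hn hL h0 hρ₁ hρ₂
    fun f' g' hf' hg' h' => by
      rw [← hS₁ f' hf', ← hS₂ g' hg', c.apply_glue]
      simp only [dropMass_apply, h']
      rw [show L 1 = c.axis L (f ^ 2) + c.swap.axis L (g ^ 2) - δ by rw [hδd]; ring]
      ring
  exact ⟨S, ρ, hS, hcard.trans (by omega)⟩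

/-- The singular case in which the kernel consists of polynomials vanishing on the axis `V = 0`. -/
theorem exists_rep_of_vanish_left (hn : 1 ≤ n)
    (hpsd : ∀ p : Poly, p.totalDegree ≤ n → 0 ≤ L (p ^ 2)) (hL : SupportedOn n L (c.conic 0))
    (hrg : ∀ p q : Poly, p.totalDegree ≤ n → q.totalDegree ≤ n → (p * q).totalDegree ≤ n →
      Ker n L p → Ker n L (p * q))
    (hleft : ∀ p : Poly, Ker n L p → ∀ u, ev (c.pt u 0) p = 0)
    (hsing : ∃ p : Poly, Ker n L p ∧ ∃ v, ev (c.pt 0 v) p ≠ 0) :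
    ∃ S ρ, IsAtomicRep n L (c.conic 0) S ρ ∧ Interp n S := by
  classical
  set Λ := c.swap.axis L with hΛ
  have hΛa : ∀ f, Λ f = L (Polynomial.aeval c.V f) := fun f => rfl
  have hXd : ∀ q : Polynomial ℝ, q ≠ 0 → (Polynomial.X * q).natDegree = q.natDegree + 1 :=
    fun q hq => Polynomial.natDegree_X_mul hq
  -- Kernel elements vanish at the origin, so on the other axis they are multiples `X * h`. A
  -- minimal such `h` is orthogonal for the functional with weight `X ^ 2`.
  have hex : ∃ d, ∃ h : Polynomial ℝ, h ≠ 0 ∧ h.natDegree = d ∧ d + 1 ≤ n ∧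
      Ker n L (Polynomial.aeval c.V (Polynomial.X * h)) := by
    obtain ⟨p, hp, v, hv⟩ := hsing
    obtain ⟨g, hg, hpg⟩ := c.swap.exists_restrict hp.1
    have hpg' : ∀ v, ev (c.pt 0 v) p = g.eval v := hpg
    have hg0 : g.coeff 0 = 0 := by
      rw [Polynomial.coeff_zero_eq_eval_zero, ← hpg', hleft p hp]
    obtain ⟨h, rfl⟩ := Polynomial.X_dvd_iff.2 hg0
    have hh0 : h ≠ 0 := by rintro rfl; exact hv (by rw [hpg']; simp)
    refine ⟨h.natDegree, h, hh0, rfl, by rwa [hXd h hh0] at hg, ?_⟩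
    refine hp.congr hL (c.totalDegree_aeval_V_le hg) (c.forall_conic_zero (fun u => ?_) fun v => ?_)
    · rw [hleft p hp, c.ev_aeval_V]; simp
    · rw [hpg', c.ev_aeval_V]
  obtain ⟨h, hh0, hhd, hdn, hhk⟩ := Nat.find_spec hex
  set d := Nat.find hex with hd
  have hmin : ∀ q : Polynomial ℝ, q ≠ 0 → q.natDegree < d →
      0 < Λ ((Polynomial.X * q) ^ 2) := by
    intro q hq hqd
    have hqn : (Polynomial.aeval c.V (Polynomial.X * q)).totalDegree ≤ n :=
      c.totalDegree_aeval_V_le (by rw [hXd q hq]; omega)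
    rw [hΛa, map_pow]
    refine (hpsd _ hqn).lt_of_ne' fun hz => ?_
    exact Nat.find_min hex hqd
      ⟨q, hq, rfl, by omega, ker_of_apply_sq_eq_zero hpsd hqn hz⟩
  have hort : ∀ q : Polynomial ℝ, q.natDegree + d + 1 ≤ 2 * n →
      Λ (Polynomial.X * h * q) = 0 := by
    intro q hq
    rw [q.as_sum_range_C_mul_X_pow, Finset.mul_sum, map_sum]
    refine Finset.sum_eq_zero fun k hk => ?_
    rw [Finset.mem_range] at hk
    rw [← Polynomial.smul_eq_C_mul, mul_smul_comm, map_smul]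
    -- Take `i = min k (n - 1 - d)`: recursive generation keeps `X * h * X ^ i` in the kernel, and
    -- `X ^ j` is the test polynomial.
    obtain ⟨i, j, hi, hj, rfl⟩ : ∃ i j, i + d + 1 ≤ n ∧ j ≤ n ∧ k = i + j :=
      ⟨k - (k - (n - 1 - d)), k - (n - 1 - d), by omega, by omega, by omega⟩
    have hXp : ∀ j ≤ n, (Polynomial.aeval c.V (Polynomial.X ^ j : Polynomial ℝ)).totalDegree ≤ n :=
      fun j hj => c.totalDegree_aeval_V_le (by rw [Polynomial.natDegree_X_pow]; exact hj)
    rw [hΛa, pow_add, ← mul_assoc, map_mul, map_mul _ (Polynomial.X * h)]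
    rw [(hrg _ _ hhk.1 (hXp i (by omega)) ?_ hhk).2 _ (hXp j hj), smul_zero]
    rw [← map_mul]
    refine c.totalDegree_aeval_V_le (Polynomial.natDegree_mul_le.trans ?_)
    rw [hXd h hh0, Polynomial.natDegree_X_pow]
    omega
  obtain ⟨hs, hnd⟩ := splits_and_nodup_of_orthogonal
    (Λ ∘ₗ LinearMap.mulLeft ℝ (Polynomial.X ^ 2)) hh0
    (fun q hq => by
      rw [LinearMap.comp_apply, LinearMap.mulLeft_apply,
        show Polynomial.X ^ 2 * (h * q) = Polynomial.X * h * (Polynomial.X * q) by ring]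
      refine hort _ ?_
      have : (Polynomial.X * q).natDegree ≤ 1 + q.natDegree :=
        Polynomial.natDegree_mul_le.trans (by rw [Polynomial.natDegree_X])
      omega)
    (fun q hq hqd => by
      rw [LinearMap.comp_apply, LinearMap.mulLeft_apply, ← mul_pow]
      exact hmin q hq (hhd ▸ hqd))
  have hhz : h.eval 0 ≠ 0 := by
    -- If `h = X * q`, then `X * h * q = (X * q) ^ 2` has value zero, contradicting minimality. So
    -- the origin is not a node.
    intro h0
    rw [← Polynomial.coeff_zero_eq_eval_zero] at h0
    obtain ⟨q, hq⟩ := Polynomial.X_dvd_iff.2 h0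
    have hq0 : q ≠ 0 := by rintro rfl; exact hh0 (by rw [hq, mul_zero])
    have hqd : q.natDegree + 1 = d := by rw [← hhd, hq, hXd q hq0]
    have h1 := hmin q hq0 (by omega)
    have h2 := hort q (by omega)
    rw [hq, show Polynomial.X * (Polynomial.X * q) * q = (Polynomial.X * q) ^ 2 by ring] at h2
    exact h1.ne' h2
  set S₂ := h.roots.toFinset with hS₂
  have hroot : ∀ z ∈ S₂, h.eval z = 0 := fun z hz =>
    (Polynomial.mem_roots hh0).1 (Multiset.mem_toFinset.1 hz)
  have h0S : (0 : ℝ) ∉ S₂ := fun h0 => hhz (hroot 0 h0)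
  have hcard : S₂.card = d := by
    rw [hS₂, Multiset.toFinset_card_of_nodup hnd, Polynomial.splits_iff_card_roots.1 hs, hhd]
  -- Quadrature only on multiples of `X`: the mass at the origin is left to the other axis.
  obtain ⟨ρ₂, hρ₂, hw⟩ := exists_weights (fun z : ℝ => Polynomial.aeval (R := ℝ) z) Λ
    ((Polynomial.degreeLT ℝ d).map (LinearMap.mulLeft ℝ Polynomial.X))
    ((Polynomial.degreeLT ℝ (2 * n)).map (LinearMap.mulLeft ℝ Polynomial.X))
    (by
      rintro _ ⟨r, hr, rfl⟩
      refine ⟨Polynomial.X * r ^ 2, ?_, by simp only [LinearMap.mulLeft_apply]; ring⟩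
      rcases eq_or_ne r 0 with rfl | hr0
      · simp
      rw [SetLike.mem_coe, Polynomial.mem_degreeLT] at hr
      have hrd := (Polynomial.natDegree_lt_iff_degree_lt hr0).2 hr
      rw [SetLike.mem_coe, Polynomial.mem_degreeLT,
        ← Polynomial.natDegree_lt_iff_degree_lt
          (mul_ne_zero Polynomial.X_ne_zero (pow_ne_zero 2 hr0)),
        hXd _ (pow_ne_zero 2 hr0), Polynomial.natDegree_pow]
      omega)
    S₂
    (by
      intro z hz
      have hz0 : z ≠ 0 := fun h => h0S (h ▸ hz)
      refine ⟨Polynomial.X * (Polynomial.C z⁻¹ * Lagrange.basis S₂ id z),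
        ⟨_, ?_, rfl⟩, ?_, fun w hw hwz => ?_⟩
      · rw [SetLike.mem_coe, Polynomial.mem_degreeLT,
          Polynomial.degree_C_mul (inv_ne_zero hz0), Lagrange.degree_basis (Set.injOn_id _) hz,
          hcard]
        have : 0 < S₂.card := Finset.card_pos.2 ⟨z, hz⟩
        exact_mod_cast (by omega : d - 1 < d)
      · change Polynomial.eval z _ = 1
        have := Lagrange.eval_basis_self (v := (id : ℝ → ℝ)) (Set.injOn_id (S₂ : Set ℝ)) hz
        rw [id] at this
        rw [Polynomial.eval_mul, Polynomial.eval_mul, this, Polynomial.eval_X,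
          Polynomial.eval_C, mul_one, mul_inv_cancel₀ hz0]
      · change Polynomial.eval w _ = 0
        have := Lagrange.eval_basis_of_ne (v := (id : ℝ → ℝ)) hwz.symm hw
        rw [id] at this
        rw [Polynomial.eval_mul, Polynomial.eval_mul, this, mul_zero, mul_zero])
    (by
      rintro _ ⟨r, hr, rfl⟩ hz
      rw [LinearMap.mulLeft_apply]
      obtain ⟨q, rfl⟩ := dvd_of_eval_roots (f := r) hh0 hs hnd fun z hzr => by
        have hzS : z ∈ S₂ := Multiset.mem_toFinset.2 hzr
        have h1 : Polynomial.eval z (Polynomial.X * r) = 0 := hz z hzS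
        rw [Polynomial.eval_mul, Polynomial.eval_X] at h1
        exact (mul_eq_zero.1 h1).resolve_left fun h => h0S (h ▸ hzS)
      rcases eq_or_ne q 0 with rfl | hq0
      · simp
      rw [SetLike.mem_coe, Polynomial.mem_degreeLT,
        ← Polynomial.natDegree_lt_iff_degree_lt (mul_ne_zero hh0 hq0),
        Polynomial.natDegree_mul hh0 hq0] at hr
      rw [← mul_assoc]
      exact hort q (by omega))
    (by
      rintro _ ⟨r, hr, rfl⟩ ⟨z, _, hz⟩
      have hr0 : r ≠ 0 := by rintro rfl; simp at hz
      rw [SetLike.mem_coe, Polynomial.mem_degreeLT,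
        ← Polynomial.natDegree_lt_iff_degree_lt hr0] at hr
      exact hmin r hr0 hr)
  have hquad : ∀ g : Polynomial ℝ, g.natDegree ≤ 2 * n →
      Λ g - g.eval 0 * L 1 = ∑ z ∈ S₂, ρ₂ z * (g.eval z - g.eval 0) := by
    intro g hg
    have hg0 : (g - Polynomial.C (g.eval 0)).coeff 0 = 0 := by
      rw [Polynomial.coeff_zero_eq_eval_zero]; simp
    obtain ⟨r, hr⟩ := Polynomial.X_dvd_iff.2 hg0
    have h1 := hw (g - Polynomial.C (g.eval 0)) ⟨r, ?_, hr.symm⟩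
    · rw [map_sub] at h1
      have h2 : Λ (Polynomial.C (g.eval 0)) = g.eval 0 * L 1 := by
        rw [hΛa, Polynomial.aeval_C, Algebra.algebraMap_eq_smul_one, map_smul, smul_eq_mul]
      rw [h2] at h1
      rw [h1]
      refine Finset.sum_congr rfl fun z _ => ?_
      change _ * Polynomial.eval z _ = _
      rw [Polynomial.eval_sub, Polynomial.eval_C]
    · rcases eq_or_ne r 0 with rfl | hr0
      · simp
      rw [SetLike.mem_coe, Polynomial.mem_degreeLT, ← Polynomial.natDegree_lt_iff_degree_lt hr0]
      have : (Polynomial.X * r).natDegree ≤ 2 * n := by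
        rw [← hr]
        exact (Polynomial.natDegree_sub_le _ _).trans (max_le hg (by simp))
      rw [hXd r hr0] at this
      omega
  obtain ⟨S₁, ρ₁, hc₁, _, hρ₁, hS₁⟩ := exists_gauss
    (dropMass (c.axis L) (∑ z ∈ S₂, ρ₂ z)) n (by
      intro f hf hfd
      -- This multiple of `h` continues `f` across the origin and vanishes at all nodes of `S₂`. The
      -- reduced functional at `f ^ 2` is therefore `L` at the glued square, which is positive since
      -- the kernel vanishes on the first axis.
      set g : Polynomial ℝ := Polynomial.C (f.eval 0 / h.eval 0) * h with hg
      have hgd : g.natDegree ≤ n := (Polynomial.natDegree_C_mul_le _ _).trans (by omega)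
      have hfg : f.eval 0 = g.eval 0 := by
        rw [hg, Polynomial.eval_mul, Polynomial.eval_C, div_mul_cancel₀ _ hhz]
      have hglue := c.totalDegree_glue_le hfd hgd
      have hval : dropMass (c.axis L) (∑ z ∈ S₂, ρ₂ z) (f ^ 2)
          = L (c.glue f g ^ 2) := by
        have h1 := hquad (g ^ 2) (Polynomial.natDegree_pow_le.trans (by omega))
        have h2 : ∑ z ∈ S₂, ρ₂ z * ((g ^ 2).eval z - (g ^ 2).eval 0)
            = - ((∑ z ∈ S₂, ρ₂ z) * (f.eval 0) ^ 2) := by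
          rw [Finset.sum_mul, ← Finset.sum_neg_distrib]
          refine Finset.sum_congr rfl fun z hz => ?_
          rw [Polynomial.eval_pow, Polynomial.eval_pow, ← hfg, hg, Polynomial.eval_mul,
            hroot z hz]
          ring
        rw [h2, Polynomial.eval_pow] at h1
        rw [c.apply_glue_sq hL hfd hgd hfg, dropMass_apply, Polynomial.eval_pow]
        linarith
      rw [hval]
      refine (hpsd _ hglue).lt_of_ne' fun hz => hf (Polynomial.funext fun u => ?_)
      rw [← c.ev_glue_left f g, hleft _ (ker_of_apply_sq_eq_zero hpsd hglue hz),
        Polynomial.eval_zero])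
  obtain ⟨S, ρ, hS, _, hSi⟩ := c.exists_isAtomicRep_of_axes hn hL h0S hρ₁ hρ₂
    fun f g hf hg h' => by
      have h1 := hquad g hg
      simp only [mul_sub, Finset.sum_sub_distrib, ← Finset.sum_mul] at h1
      rw [← hS₁ f hf, c.apply_glue, dropMass_apply, h']
      linarith
  exact ⟨S, ρ, hS, hSi hc₁.le (by omega)⟩

variable (c : Coords) {n : ℕ} {L : Poly →ₗ[ℝ] ℝ}

theorem pt_of_V_eq_zero {z : ℝ × ℝ} (h : ev z c.V = 0) : c.pt (ev z c.U) 0 = z := by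
  rw [← h, c.pt_ev]

/-- If a polynomial of degree `≤ n` vanishes on `S` but not on the axis `V = 0`, then `S` has at
most `n` points on that axis. -/
theorem card_filter_le {S : Finset (ℝ × ℝ)} {p : Poly} (hp : p.totalDegree ≤ n)
    (hpS : ∀ z ∈ S, ev z p = 0) {u : ℝ} (hu : ev (c.pt u 0) p ≠ 0) :
    (S.filter fun z => ev z c.V = 0).card ≤ n := by
  obtain ⟨f, hf, hpf⟩ := c.exists_restrict hp
  have hv : Set.InjOn (fun z => ev z c.U) (S.filter fun z => ev z c.V = 0) :=
    c.injOn_left.mono fun z hz => (Finset.mem_filter.1 (Finset.mem_coe.1 hz)).2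
  have hdvd := nodal_dvd hv (f := f) fun z hz => by
    rw [Finset.mem_filter] at hz
    rw [← hpf, c.pt_of_V_eq_zero hz.2, hpS z hz.1]
  have hf0 : f ≠ 0 := by
    rintro rfl
    exact hu (by rw [hpf, Polynomial.eval_zero])
  have := Polynomial.natDegree_le_of_dvd hdvd hf0
  rw [Lagrange.natDegree_nodal] at this
  exact this.trans hf

/-- The polynomial with value `1` at the origin and simple zeros at the other points of `S` on the
axis `V = 0`. -/
theorem exists_edge {S : Finset (ℝ × ℝ)} (hS : (S.filter fun z => ev z c.V = 0).card ≤ n) :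
    ∃ f : Polynomial ℝ, f.eval 0 = 1 ∧ f.natDegree ≤ n ∧ (c.pt 0 0 ∈ S → f.natDegree < n) ∧
      (∀ z ∈ S, ev z c.V = 0 → ev z c.U ≠ 0 → f.eval (ev z c.U) = 0) ∧
      ∀ g : Polynomial ℝ, (∀ z ∈ S, ev z c.V = 0 → g.eval (ev z c.U) = 0) → f ∣ g := by
  classical
  set S₁ := S.filter fun z => ev z c.V = 0 ∧ ev z c.U ≠ 0 with hS₁
  have hsub : S₁ ⊆ S.filter fun z => ev z c.V = 0 := fun z hz => by
    rw [Finset.mem_filter] at hz ⊢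
    exact ⟨hz.1, hz.2.1⟩
  have hv : Set.InjOn (fun z => ev z c.U) S₁ :=
    c.injOn_left.mono fun z hz => (Finset.mem_filter.1 (Finset.mem_coe.1 hz)).2.1
  set h := Lagrange.nodal S₁ (fun z => ev z c.U) with hh
  have hh0 : h.eval 0 ≠ 0 := by
    rw [hh, Lagrange.eval_nodal, Finset.prod_ne_zero_iff]
    intro z hz
    rw [zero_sub, neg_ne_zero]
    exact (Finset.mem_filter.1 hz).2.2
  have hd : (Polynomial.C (h.eval 0)⁻¹ * h).natDegree = S₁.card := by
    rw [Polynomial.natDegree_C_mul (inv_ne_zero hh0)]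
    exact Lagrange.natDegree_nodal
  refine ⟨Polynomial.C (h.eval 0)⁻¹ * h, ?_, ?_, fun h0 => ?_, fun z hz hz0 hz1 => ?_,
    fun g hg => ?_⟩
  · rw [Polynomial.eval_mul, Polynomial.eval_C, inv_mul_cancel₀ hh0]
  · exact hd.trans_le ((Finset.card_le_card hsub).trans hS)
  · rw [hd]
    refine (Finset.card_lt_card (hsub.ssubset_of_ne fun he => ?_)).trans_le hS
    have hmem : c.pt 0 0 ∈ S.filter fun z => ev z c.V = 0 := Finset.mem_filter.2 ⟨h0, c.ev_V 0 0⟩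
    rw [← he, Finset.mem_filter] at hmem
    exact hmem.2.2 (c.ev_U 0 0)
  · rw [Polynomial.eval_mul, hh, Lagrange.eval_nodal_at_node (v := fun z => ev z c.U)
      (Finset.mem_filter.2 ⟨hz, hz0, hz1⟩), mul_zero]
  · obtain ⟨q, rfl⟩ := nodal_dvd hv (f := g) fun z hz => by
      rw [Finset.mem_filter] at hz
      exact hg z hz.1 hz.2.1
    refine ⟨Polynomial.C (h.eval 0) * q, ?_⟩
    have hC : Polynomial.C (h.eval 0)⁻¹ * Polynomial.C (h.eval 0) = 1 := by
      rw [← Polynomial.C_mul, inv_mul_cancel₀ hh0, Polynomial.C_1]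
    linear_combination -(h * q) * hC

/-- Only the constant term of `q` contributes, since `L` kills `f * X ^ k` for `k ≥ 1`. If `f` has
degree below `n`, a factor `f * X ^ i` with `i ≥ 1` fits in the kernel. In degree `n` there is no
room; then the glued polynomial replaces `f`, because `U ^ k` vanishes on the other axis. -/
theorem axis_edge_mul (hL : SupportedOn n L (c.conic 0)) {f g : Polynomial ℝ}
    (hk : ∀ i, 1 ≤ i → f.natDegree + i ≤ n →
      Ker n L (Polynomial.aeval c.U (f * Polynomial.X ^ i)))
    (hD : f.natDegree < n ∨ Ker n L (c.glue f g)) {q : Polynomial ℝ}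
    (hq : f.natDegree + q.natDegree ≤ 2 * n) :
    c.axis L (f * q) = q.eval 0 * c.axis L f := by
  have hXp : ∀ j ≤ n, (Polynomial.aeval c.U (Polynomial.X ^ j : Polynomial ℝ)).totalDegree ≤ n :=
    fun j hj => c.totalDegree_aeval_U_le (by rw [Polynomial.natDegree_X_pow]; exact hj)
  have key : ∀ k, 1 ≤ k → f.natDegree + k ≤ 2 * n → c.axis L (f * Polynomial.X ^ k) = 0 := by
    intro k hk1 hk2
    by_cases hlt : f.natDegree < n
    · obtain ⟨i, j, hi, hj, hj', rfl⟩ :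
          ∃ i j, 1 ≤ i ∧ f.natDegree + i ≤ n ∧ j ≤ n ∧ k = i + j := by
        rcases le_total k (n - f.natDegree) with h | h
        · exact ⟨k, 0, by omega, by omega, by omega, by omega⟩
        · exact ⟨n - f.natDegree, k - (n - f.natDegree), by omega, by omega, by omega, by omega⟩
      rw [axis_apply, pow_add, ← mul_assoc, map_mul]
      exact (hk i hi hj).2 _ (hXp j hj')
    · have hD' := hD.resolve_left hlt
      rw [axis_apply, ← hD'.2 _ (hXp k (by omega))]
      refine hL.congr (c.totalDegree_aeval_U_le (Polynomial.natDegree_mul_le.trans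
        (by rw [Polynomial.natDegree_X_pow]; exact hk2)))
        (totalDegree_mul_le_two_mul hD'.1 (hXp k (by omega)))
        (c.forall_conic_zero (fun u => ?_) fun v => ?_)
      · rw [map_mul, map_mul, map_mul, c.ev_aeval_U, c.ev_glue_left]
      · rw [map_mul, map_mul, map_mul, c.ev_aeval_U, c.ev_aeval_U, Polynomial.eval_pow,
          Polynomial.eval_X, zero_pow (by omega), mul_zero, mul_zero]
  conv_lhs => rw [q.as_sum_range_C_mul_X_pow, Finset.mul_sum, map_sum]
  rw [Finset.sum_eq_single 0]
  · rw [pow_zero, mul_one, mul_comm, ← Polynomial.smul_eq_C_mul, map_smul,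
      Polynomial.coeff_zero_eq_eval_zero, smul_eq_mul]
  · intro k hk hk0
    rw [Finset.mem_range] at hk
    rw [← Polynomial.smul_eq_C_mul, mul_smul_comm, map_smul, key k (by omega) (by omega), smul_zero]
  · simp

theorem glue_swap {f g : Polynomial ℝ} (h : f.eval 0 = g.eval 0) :
    c.swap.glue g f = c.glue f g := by
  rw [glue, glue, h, add_comm (Polynomial.aeval _ _)]
  rfl

theorem ker_edge_X_pow {S : Finset (ℝ × ℝ)} (hS : ↑S ⊆ c.conic 0)
    (hSk : ∀ p : Poly, p.totalDegree ≤ n → (∀ z ∈ S, ev z p = 0) → Ker n L p)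
    {f : Polynomial ℝ} (hf : ∀ z ∈ S, ev z c.V = 0 → ev z c.U ≠ 0 → f.eval (ev z c.U) = 0) :
    ∀ i, 1 ≤ i → f.natDegree + i ≤ n → Ker n L (Polynomial.aeval c.U (f * Polynomial.X ^ i)) := by
  intro i hi hfi
  refine hSk _ (c.totalDegree_aeval_U_le (Polynomial.natDegree_mul_le.trans
    (by rw [Polynomial.natDegree_X_pow]; exact hfi))) fun z hz => ?_
  rw [← c.pt_ev z, c.ev_aeval_U, Polynomial.eval_mul, Polynomial.eval_pow, Polynomial.eval_X]
  by_cases hu : ev z c.U = 0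
  · rw [hu, zero_pow (by omega), mul_zero]
  · rw [hf z hz ((mul_eq_zero.1 (hS hz)).resolve_left hu) hu, zero_mul]

variable {β : ℕ → ℕ → ℝ}

/-- The singular case in which the kernel does not vanish identically on either of the axes. -/
theorem exists_rep_of_not_vanish (hn : 1 ≤ n)
    (hpsd : ∀ p : Poly, p.totalDegree ≤ n → 0 ≤ riesz β (p ^ 2))
    (hL : SupportedOn n (riesz β) (c.conic 0)) (hV : momentVariety n β ⊆ c.conic 0)
    (hr : ((momentMatrix n β).rank : ℕ∞) ≤ (momentVariety n β).encard)
    (hleft : ∃ p : Poly, Ker n (riesz β) p ∧ ∃ u, ev (c.pt u 0) p ≠ 0)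
    (hright : ∃ p : Poly, Ker n (riesz β) p ∧ ∃ v, ev (c.pt 0 v) p ≠ 0) :
    ∃ S ρ, IsAtomicRep n (riesz β) (c.conic 0) S ρ ∧ Interp n S := by
  classical
  obtain ⟨p₁, hp₁, u₁, hu₁⟩ := hleft
  obtain ⟨p₂, hp₂, v₂, hv₂⟩ := hright
  have hcard₁ : ∀ S : Finset (ℝ × ℝ), ↑S ⊆ momentVariety n β →
      (S.filter fun z => ev z c.V = 0).card ≤ n := fun S hS =>
    c.card_filter_le hp₁.1 (fun z hz => mem_momentVariety.1 (hS hz) p₁ hp₁) hu₁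
  have hcard₂ : ∀ S : Finset (ℝ × ℝ), ↑S ⊆ momentVariety n β →
      (S.filter fun z => ev z c.U = 0).card ≤ n := fun S hS =>
    c.swap.card_filter_le hp₂.1 (fun z hz => mem_momentVariety.1 (hS hz) p₂ hp₂) hv₂
  have hne : ∀ S : Finset (ℝ × ℝ), ↑S ⊆ momentVariety n β →
      (S.filter fun z => ev z c.V ≠ 0).card ≤ n := fun S hS => by
    refine (Finset.card_le_card fun z hz => ?_).trans (hcard₂ S hS)
    rw [Finset.mem_filter] at hz ⊢
    exact ⟨hz.1, (mul_eq_zero.1 (hV (hS hz.1))).resolve_right hz.2⟩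
  have hfin : (momentVariety n β).Finite := by
    by_contra hinf
    obtain ⟨S, hS, hcard⟩ := Set.Infinite.exists_subset_card_eq hinf (2 * n + 1)
    have h1 := hcard₁ S hS
    have h2 := hne S hS
    simp only [ne_eq] at h2
    have h3 := Finset.card_filter_add_card_filter_not (s := S) (fun z => ev z c.V = 0)
    omega
  obtain ⟨S, hS⟩ := hfin.exists_finset_coe
  have hSZ : ↑S ⊆ c.conic 0 := hS ▸ hV
  have hSi := c.interp_of_subset_conic_zero hn hSZ
    ((hcard₁ S hS.le).trans (Nat.le_succ n)) (hne S hS.le)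
  have hSk := ker_of_rank_le_encard hS hSi hr
  suffices hSL : SupportedOn n (riesz β) S by
    obtain ⟨ρ, hρ⟩ := exists_isAtomicRep hpsd hSZ hSi
      (fun q hq z hz => mem_momentVariety.1 (hS ▸ Finset.mem_coe.2 hz) q hq) hSL
    exact ⟨S, ρ, hρ, hSi⟩
  obtain ⟨f, hf0, hfd, hfo, hfz, hfdvd⟩ := c.exists_edge (hcard₁ S hS.le)
  obtain ⟨g, hg0, hgd, hgo, hgz, hgdvd⟩ := c.swap.exists_edge (hcard₂ S hS.le)
  have hfg : f.eval 0 = g.eval 0 := hf0.trans hg0.symm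
  -- If the origin is not in the variety, `f` and `g` have all its points as zeros, so gluing them
  -- gives a kernel element.
  have hD : c.pt 0 0 ∈ S ∨ Ker n (riesz β) (c.glue f g) := by
    by_cases hO : c.pt 0 0 ∈ S
    · exact Or.inl hO
    refine Or.inr (hSk _ (c.totalDegree_glue_le hfd hgd) fun z hz => ?_)
    have hz' : ¬ (ev z c.U = 0 ∧ ev z c.V = 0) := fun h => hO (by
      rw [← c.pt_ev z, h.1, h.2] at hz
      exact hz)
    rcases mul_eq_zero.1 (hSZ hz) with h | h
    · rw [← c.pt_ev z, h, c.ev_glue_right hfg]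
      exact hgz z hz h fun h' => hz' ⟨h, h'⟩
    · rw [← c.pt_ev z, h, c.ev_glue_left]
      exact hfz z hz h fun h' => hz' ⟨h', h⟩
  intro p hp hpS
  obtain ⟨a, had, hpa⟩ := c.exists_restrict hp
  obtain ⟨b, hbd, hpb⟩ := c.swap.exists_restrict hp
  have ha0 : ev (c.pt 0 0) p = a.eval 0 := hpa 0
  have hb0 : ev (c.pt 0 0) p = b.eval 0 := hpb 0
  obtain ⟨q, rfl⟩ := hfdvd a fun z hz h => by
    rw [← hpa, c.pt_of_V_eq_zero h, hpS z hz]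
  obtain ⟨r, rfl⟩ := hgdvd b fun z hz h => by
    rw [← hpb, c.swap.pt_of_V_eq_zero h, hpS z hz]
  have hdeg : ∀ {x y : Polynomial ℝ}, x.natDegree ≤ n → x ≠ 0 → (x * y).natDegree ≤ 2 * n →
      x.natDegree + y.natDegree ≤ 2 * n := by
    intro x y hx hx0 h
    rcases eq_or_ne y 0 with rfl | hy
    · rw [Polynomial.natDegree_zero]; omega
    · rwa [Polynomial.natDegree_mul hx0 hy] at h
  have hfn : f ≠ 0 := by rintro rfl; simp at hf0
  have hgn : g ≠ 0 := by rintro rfl; simp at hg0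
  have e1 := c.axis_edge_mul hL (c.ker_edge_X_pow hSZ hSk hfz) (hD.imp_left hfo)
    (hdeg hfd hfn had)
  have e2 := c.swap.axis_edge_mul (by rwa [c.swap_conic])
    (c.swap.ker_edge_X_pow (by rwa [c.swap_conic]) hSk hgz)
    (hD.imp hgo fun h => by rwa [c.glue_swap hfg]) (hdeg hgd hgn hbd)
  -- As `f 0 = g 0 = 1`, the value of `L` at `p` is the value of `p` at the origin times `L (c.glue
  -- f g)`. One of the two factors is zero in either case of `hD`.
  rw [c.apply_eq_apply_glue hL hp had hbd hpa hpb, c.apply_glue, e1, e2]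
  rw [Polynomial.eval_mul, hf0, one_mul] at ha0
  rw [Polynomial.eval_mul, hg0, one_mul] at hb0
  rw [Polynomial.eval_mul, hg0, one_mul, ← ha0, ← hb0]
  rcases hD with hO | hD
  · rw [hpS _ hO]; ring
  · have := hD.2 1 (by rw [totalDegree_one]; exact Nat.zero_le _)
    rw [mul_one, c.apply_glue, hg0] at this
    linear_combination (ev (c.pt 0 0) p) * this

theorem vanish_left_of_card {T : Finset ℝ} (hT : n + 1 ≤ T.card) {p : Poly}
    (hp : p.totalDegree ≤ n) (h : ∀ t ∈ T, ev (c.pt t 0) p = 0) : ∀ u, ev (c.pt u 0) p = 0 := by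
  obtain ⟨f, hf, hpf⟩ := c.exists_restrict hp
  have hf0 : f = 0 := Polynomial.eq_zero_of_degree_lt_of_eval_finset_eq_zero T
    (Polynomial.degree_le_natDegree.trans_lt (by exact_mod_cast (by omega : f.natDegree < T.card)))
    fun t ht => by rw [← hpf, h t ht]
  intro u
  rw [hpf, hf0, Polynomial.eval_zero]

/-- The main theorem on the pair of lines `U V = 0`. -/
theorem solvable_conic_zero (hn : 1 ≤ n)
    (hpsd : ∀ p : Poly, p.totalDegree ≤ n → 0 ≤ riesz β (p ^ 2))
    (hL : SupportedOn n (riesz β) (c.conic 0)) (hV : momentVariety n β ⊆ c.conic 0)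
    (hrg : ∀ p q : Poly, p.totalDegree ≤ n → q.totalDegree ≤ n → (p * q).totalDegree ≤ n →
      Ker n (riesz β) p → Ker n (riesz β) (p * q))
    (hr : ((momentMatrix n β).rank : ℕ∞) ≤ (momentVariety n β).encard) :
    Solvable n β (c.conic 0) := by
  classical
  -- The frame is `0, …, n` on one axis and `1, …, n` on the other, the origin counted once.
  set T : Finset ℝ := (Finset.range (n + 1)).image fun i : ℕ => (i : ℝ) with hT
  have hTc : T.card = n + 1 := by
    rw [hT, Finset.card_image_of_injective _ Nat.cast_injective, Finset.card_range]
  have hT0 : (0 : ℝ) ∈ T := Finset.mem_image.2 ⟨0, by simp, by simp⟩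
  set A := T.image fun t => c.pt t 0 with hA
  set B := (T.erase 0).image fun t => c.pt 0 t with hB
  have hAc : A.card = n + 1 := by
    rw [hA, Finset.card_image_of_injective _ (fun s t h => ?_), hTc]
    rw [← c.ev_U s 0, ← c.ev_U t 0]
    exact congrArg (fun z => ev z c.U) h
  have hBc : B.card = n := by
    rw [hB, Finset.card_image_of_injective _ (fun s t h => ?_), Finset.card_erase_of_mem hT0, hTc,
      Nat.add_sub_cancel]
    rw [← c.ev_V 0 s, ← c.ev_V 0 t]
    exact congrArg (fun z => ev z c.V) h
  have hAV : ∀ z ∈ A, ev z c.V = 0 := by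
    intro z hz
    obtain ⟨t, _, rfl⟩ := Finset.mem_image.1 hz
    exact c.ev_V t 0
  have hBV : ∀ z ∈ B, ev z c.V ≠ 0 := by
    intro z hz
    obtain ⟨t, ht, rfl⟩ := Finset.mem_image.1 hz
    rw [c.ev_V]
    exact (Finset.mem_erase.1 ht).1
  have hdisj : Disjoint A B := Finset.disjoint_left.2 fun z h₁ h₂ => hBV z h₂ (hAV z h₁)
  have hsub : ↑(A ∪ B) ⊆ c.conic 0 := by
    intro z hz
    rcases Finset.mem_union.1 (Finset.mem_coe.1 hz) with hz | hz
    · obtain ⟨t, _, rfl⟩ := Finset.mem_image.1 hz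
      exact c.pt_left_mem t
    · obtain ⟨t, _, rfl⟩ := Finset.mem_image.1 hz
      exact c.pt_right_mem t
  have hint : Interp n (A ∪ B) := by
    refine c.interp_of_subset_conic_zero hn hsub (hAc ▸ Finset.card_le_card fun z hz => ?_)
      (hBc ▸ Finset.card_le_card fun z hz => ?_)
    · rw [Finset.mem_filter, Finset.mem_union] at hz
      exact hz.1.resolve_right fun h => hBV z h hz.2
    · rw [Finset.mem_filter, Finset.mem_union] at hz
      exact hz.1.resolve_left fun h => hz.2 (hAV z h)
  refine solvable_of_frame hL (by rw [Finset.card_union_of_disjoint hdisj]; omega) hint hsub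
    (fun p hp hz => c.forall_conic_zero ?_ ?_) (fun p hp hz => ?_)
    (c.exists_rep_of_regular hn hpsd hL)
  · exact c.vanish_left_of_card hTc.ge hp fun t ht =>
      hz _ (Finset.mem_union_left _ (Finset.mem_image_of_mem _ ht))
  · refine c.swap.vanish_left_of_card hTc.ge hp fun t ht => ?_
    rcases eq_or_ne t 0 with rfl | ht0
    · exact hz _ (Finset.mem_union_left _ (Finset.mem_image_of_mem _ hT0))
    · exact hz _ (Finset.mem_union_right _ (Finset.mem_image_of_mem _ (Finset.mem_erase.2 ⟨ht0, ht⟩)))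
  · by_cases hleft : ∃ p : Poly, Ker n (riesz β) p ∧ ∃ u, ev (c.pt u 0) p ≠ 0
    · by_cases hright : ∃ p : Poly, Ker n (riesz β) p ∧ ∃ v, ev (c.pt 0 v) p ≠ 0
      · exact c.exists_rep_of_not_vanish hn hpsd hL hV hr hleft hright
      · push Not at hright
        rw [← c.swap_conic] at hL ⊢
        exact c.swap.exists_rep_of_vanish_left hn hpsd hL hrg hright hleft
    · push Not at hleft
      refine c.exists_rep_of_vanish_left hn hpsd hL hrg hleft ⟨p, hp, ?_⟩
      by_contra! h
      obtain ⟨z, hzZ, hne⟩ := hz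
      exact hne (c.forall_conic_zero (φ := fun z => ev z p = 0) (hleft p hp) h z hzZ)

end Coords

/-! ### Normal form of the conic and sufficiency -/

theorem eq_quadratic {Q : Poly} (hQ : Q.totalDegree ≤ 2) :
    Q = C (coeffYX Q 0 0) + C (coeffYX Q 0 1) * X 0 + C (coeffYX Q 1 0) * X 1
      + C (coeffYX Q 0 2) * X 0 ^ 2 + C (coeffYX Q 1 1) * (X 0 * X 1)
      + C (coeffYX Q 2 0) * X 1 ^ 2 := by
  conv_lhs => rw [eq_ofCoeffs hQ, ofCoeffs_apply]
  rw [Finset.sum_coe_sort (exps 2) fun e : ℕ × ℕ => coeffYX Q e.1 e.2 • mon e,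
    show exps 2 = {(0, 0), (0, 1), (1, 0), (0, 2), (1, 1), (2, 0)} by decide]
  simp [mon, smul_eq_C_mul]
  ring

theorem exists_linear_factors {a b c : ℝ} (h : 0 < b ^ 2 - 4 * a * c) :
    ∃ a₁ b₁ a₂ b₂ : ℝ, a₁ * b₂ - a₂ * b₁ ≠ 0 ∧ a₁ * a₂ = a ∧ a₁ * b₂ + a₂ * b₁ = b ∧
      b₁ * b₂ = c := by
  rcases eq_or_ne a 0 with rfl | ha
  · refine ⟨0, 1, b, c, ?_, by ring, by ring, by ring⟩
    rintro h0
    have : b = 0 := by linarith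
    rw [this] at h
    norm_num at h
  · have hs := Real.sq_sqrt h.le
    have hs0 := Real.sqrt_pos.2 h
    set s := Real.sqrt (b ^ 2 - 4 * a * c)
    refine ⟨a, (b + s) / 2, 1, (b - s) / (2 * a), ?_, by ring, by field_simp; ring, ?_⟩
    · have : a * ((b - s) / (2 * a)) - 1 * ((b + s) / 2) = -s := by field_simp; ring
      rw [this]
      exact neg_ne_zero.2 hs0.ne'
    · field_simp
      linear_combination (-1) * hs

/-- Positive discriminant splits the quadratic part into two independent linear forms. Suitable
constants absorb the linear part, and what remains is a constant: if zero, two lines; otherwise it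
is scaled to `1` through `U`. -/
theorem exists_coords {Q : Poly} (hQ : IsHyperbola Q) :
    ∃ (c : Coords) (κ r : ℝ), (κ = 0 ∨ κ = 1) ∧ r ≠ 0 ∧ Q = C r * (c.U * c.V - C κ) := by
  obtain ⟨hdeg, hdisc⟩ := hQ
  have hQe := eq_quadratic hdeg.le
  set a := coeffYX Q 0 2
  set b := coeffYX Q 1 1
  set c := coeffYX Q 2 0
  set d := coeffYX Q 0 1
  set e := coeffYX Q 1 0
  set f := coeffYX Q 0 0
  obtain ⟨a₁, b₁, a₂, b₂, hD, h1, h2, h3⟩ := exists_linear_factors hdisc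
  -- Cramer's rule; the determinant is nonzero by `hD`.
  obtain ⟨c₁, c₂, h4, h5⟩ : ∃ c₁ c₂ : ℝ, a₁ * c₂ + a₂ * c₁ = d ∧ b₁ * c₂ + b₂ * c₁ = e := by
    refine ⟨(a₁ * e - b₁ * d) / (a₁ * b₂ - a₂ * b₁), (d * b₂ - e * a₂) / (a₁ * b₂ - a₂ * b₁),
      ?_, ?_⟩
    · rw [← mul_div_assoc, ← mul_div_assoc, ← add_div, div_eq_iff hD]; ring
    · rw [← mul_div_assoc, ← mul_div_assoc, ← add_div, div_eq_iff hD]; ring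
  have g1 := congrArg (C : ℝ → Poly) h1
  have g2 := congrArg (C : ℝ → Poly) h2
  have g3 := congrArg (C : ℝ → Poly) h3
  have g4 := congrArg (C : ℝ → Poly) h4
  have g5 := congrArg (C : ℝ → Poly) h5
  simp only [map_add, map_mul] at g1 g2 g3 g4 g5
  rcases eq_or_ne (c₁ * c₂ - f) 0 with hk | hk
  · obtain ⟨co, hU, hV⟩ := Coords.exists_of_det_ne_zero a₁ b₁ c₁ a₂ b₂ c₂ hD
    refine ⟨co, 0, 1, Or.inl rfl, one_ne_zero, ?_⟩
    have g6 := congrArg (C : ℝ → Poly) hk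
    simp only [map_sub, map_mul, map_zero] at g6
    rw [hU, hV, hQe, C_1, C_0]
    linear_combination (-X 0 ^ 2) * g1 - X 0 * X 1 * g2 - X 1 ^ 2 * g3 - X 0 * g4 - X 1 * g5 - g6
  · set k := c₁ * c₂ - f with hkd
    obtain ⟨co, hU, hV⟩ := Coords.exists_of_det_ne_zero (k⁻¹ * a₁) (k⁻¹ * b₁) (k⁻¹ * c₁) a₂ b₂ c₂
      (by
        rw [show k⁻¹ * a₁ * b₂ - a₂ * (k⁻¹ * b₁) = k⁻¹ * (a₁ * b₂ - a₂ * b₁) by ring]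
        exact mul_ne_zero (inv_ne_zero hk) hD)
    refine ⟨co, 1, k, Or.inr rfl, hk, ?_⟩
    have g6 := congrArg (C : ℝ → Poly) hkd
    have g7 := congrArg (C : ℝ → Poly) (mul_inv_cancel₀ hk)
    simp only [map_sub, map_mul, map_one] at g6 g7
    rw [hU, hV, hQe, C_1]
    simp only [map_mul]
    linear_combination (-X 0 ^ 2) * g1 - X 0 * X 1 * g2 - X 1 ^ 2 * g3 - X 0 * g4 - X 1 * g5 + g6
      - (C a₁ * X 0 + C b₁ * X 1 + C c₁) * (C a₂ * X 0 + C b₂ * X 1 + C c₂) * g7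

/-- A monomial of degree at most `2 n - 2` is a product of one of degree at most `n - 2`, absorbed
into the kernel element `Q` by recursive generation, and one of degree at most `n`, the test
polynomial. -/
theorem apply_mul_eq_zero_of_ker {n : ℕ} (hn : 2 ≤ n) {L : Poly →ₗ[ℝ] ℝ} {Q : Poly}
    (hQ : Q.totalDegree ≤ 2) (hk : Ker n L Q)
    (hrg : ∀ p q : Poly, p.totalDegree ≤ n → q.totalDegree ≤ n → (p * q).totalDegree ≤ n →
      Ker n L p → Ker n L (p * q))
    {r : Poly} (hr : r.totalDegree + 2 ≤ 2 * n) : L (Q * r) = 0 := by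
  rw [eq_ofCoeffs (show r.totalDegree ≤ 2 * n - 2 by omega), ofCoeffs_apply, Finset.mul_sum,
    map_sum]
  refine Finset.sum_eq_zero fun e _ => ?_
  rw [mul_smul_comm, map_smul]
  obtain ⟨e₁, e₂, he, he₁, he₂⟩ : ∃ e₁ e₂ : ℕ × ℕ, e₁ + e₂ = e.1 ∧ e₁.1 + e₁.2 ≤ n - 2 ∧
      e₂.1 + e₂.2 ≤ n := by
    obtain ⟨⟨i, j⟩, hij⟩ := e
    have := mem_exps.1 hij
    simp only at this
    refine ⟨(min i (n - 2), min j (n - 2 - min i (n - 2))),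
      (i - min i (n - 2), j - min j (n - 2 - min i (n - 2))), ?_, ?_, ?_⟩
    · ext <;> simp
    · simp only; omega
    · simp only; omega
  have hm := totalDegree_mon e₁
  rw [← he, ← mon_mul, ← mul_assoc, (hrg Q (mon e₁) hk.1 (by omega)
    ((totalDegree_mul _ _).trans (by omega)) hk).2 _ ((totalDegree_mon e₂).trans he₂), smul_zero]

/-- The four conditions of the main theorem give atomic representations. -/
theorem solvable {n : ℕ} (hn : 2 ≤ n) {Q : Poly} (hQ : IsHyperbola Q) {β : ℕ → ℕ → ℝ}
    (hpsd : (momentMatrix n β).PosSemidef) (hrg : RecursivelyGenerated n β)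
    (hcol : polyCol n β Q = 0)
    (hr : ((momentMatrix n β).rank : ℕ∞) ≤ (momentVariety n β).encard) :
    Solvable n β (zeroSet Q) := by
  have hQd : Q.totalDegree ≤ n := hQ.1.le.trans hn
  have hQk := (ker_iff_polyCol n β hQd).2 hcol
  have hrg' : ∀ p q : Poly, p.totalDegree ≤ n → q.totalDegree ≤ n → (p * q).totalDegree ≤ n →
      Ker n (riesz β) p → Ker n (riesz β) (p * q) := fun p q hp hq hpq hk =>
    (ker_iff_polyCol n β hpq).2 (hrg p q hp hq hpq ((ker_iff_polyCol n β hp).1 hk))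
  rw [posSemidef_iff] at hpsd
  obtain ⟨c, κ, r, hκ, hr0, hQe⟩ := exists_coords hQ
  have hZ : zeroSet Q = c.conic κ := by
    ext z
    rw [mem_zeroSet, hQe, map_mul, map_sub, map_mul, Coords.ev_C, Coords.ev_C, mul_eq_zero,
      or_iff_right hr0, sub_eq_zero]
    rfl
  have hV : momentVariety n β ⊆ c.conic κ := fun z hz => by
    rw [← hZ]
    exact mem_momentVariety.1 hz Q hQk
  have hL : ∀ p : Poly, p.totalDegree + 2 ≤ 2 * n →
      riesz β ((c.U * c.V - C κ) * p) = 0 := fun p hp => by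
    have := apply_mul_eq_zero_of_ker hn hQ.1.le hQk hrg' hp
    rw [hQe, mul_assoc, ← smul_eq_C_mul, map_smul, smul_eq_mul] at this
    exact (mul_eq_zero.1 this).resolve_left hr0
  rw [hZ]
  rcases hκ with rfl | rfl
  · exact c.solvable_conic_zero (by omega) hpsd
      (fun p hp hz => c.apply_eq_zero_of_conic_zero hL hp hz) hV hrg' hr
  · exact c.solvable_conic_one hpsd
      (fun p hp hz => c.apply_eq_zero_of_conic_one hL hp hz) hV hr

/-! ### Measures and necessity -/

theorem continuous_ev (p : Poly) : Continuous fun z : ℝ × ℝ => ev z p := by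
  refine (MvPolynomial.continuous_eval p).comp (continuous_pi fun i => ?_)
  fin_cases i
  · exact continuous_fst
  · exact continuous_snd

theorem isClosed_zeroSet (p : Poly) : IsClosed (zeroSet p) :=
  isClosed_singleton.preimage (continuous_ev p)

/-- The atomic measure with masses `ρ` on `S`. -/
noncomputable def atomic (S : Finset (ℝ × ℝ)) (ρ : ℝ × ℝ → ℝ) : Measure (ℝ × ℝ) :=
  ∑ z ∈ S, ENNReal.ofReal (ρ z) • Measure.dirac z

theorem support_atomic_subset (S : Finset (ℝ × ℝ)) (ρ : ℝ × ℝ → ℝ) :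
    (atomic S ρ).support ⊆ S := by
  refine Measure.support_subset_of_isClosed S.finite_toSet.isClosed ?_
  rw [mem_ae_iff, atomic, Measure.finsetSum_apply]
  refine Finset.sum_eq_zero fun z hz => ?_
  rw [Measure.smul_apply, Measure.dirac_apply' _ S.finite_toSet.measurableSet.compl]
  simp [hz]

theorem integrable_atomic (S : Finset (ℝ × ℝ)) (ρ : ℝ × ℝ → ℝ) (f : ℝ × ℝ → ℝ) :
    Integrable f (atomic S ρ) :=
  integrable_finsetSum_measure.2 fun _ _ =>
    (integrable_dirac (by simp)).smul_measure ENNReal.ofReal_ne_top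

theorem integral_atomic {S : Finset (ℝ × ℝ)} {ρ : ℝ × ℝ → ℝ} (hρ : ∀ z ∈ S, 0 < ρ z)
    (f : ℝ × ℝ → ℝ) : ∫ z, f z ∂(atomic S ρ) = ∑ z ∈ S, ρ z * f z := by
  rw [atomic, integral_finsetSum_measure fun _ _ =>
    (integrable_dirac (by simp)).smul_measure ENNReal.ofReal_ne_top]
  refine Finset.sum_congr rfl fun z hz => ?_
  rw [integral_smul_measure, integral_dirac, ENNReal.toReal_ofReal (hρ z hz).le, smul_eq_mul]

theorem IsAtomicRep.isQRepresenting {n : ℕ} {β : ℕ → ℕ → ℝ} {Q : Poly} {S : Finset (ℝ × ℝ)}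
    {ρ : ℝ × ℝ → ℝ} (h : IsAtomicRep n (riesz β) (zeroSet Q) S ρ) :
    IsQRepresenting n β Q (atomic S ρ) := by
  refine ⟨fun i j hij => ⟨integrable_atomic _ _ _, ?_⟩, (support_atomic_subset S ρ).trans h.2.1⟩
  rw [integral_atomic h.1, ← riesz_mon β (i, j), h.2.2 _ ((totalDegree_mon _).trans hij)]
  simp only [ev_mon]

section representing

variable {n : ℕ} {β : ℕ → ℕ → ℝ} {μ : Measure (ℝ × ℝ)}

theorem IsRepresenting.integral_eq (h : IsRepresenting n β μ) {p : Poly}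
    (hp : p.totalDegree ≤ 2 * n) :
    Integrable (fun z => ev z p) μ ∧ riesz β p = ∫ z, ev z p ∂μ := by
  have hint : ∀ e ∈ (Finset.univ : Finset (Idx (2 * n))), Integrable (fun z : ℝ × ℝ =>
      coeffYX p e.1.1 e.1.2 * (z.2 ^ e.1.1 * z.1 ^ e.1.2)) μ := fun e _ =>
    ((h _ _ (mem_exps.1 e.2)).1).const_mul _
  have hev : ∀ z, ev z p = ∑ e : Idx (2 * n),
      coeffYX p e.1.1 e.1.2 * (z.2 ^ e.1.1 * z.1 ^ e.1.2) := fun z => by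
    conv_lhs => rw [eq_ofCoeffs hp, ofCoeffs_apply]
    simp only [map_sum, map_smul, ev_mon, smul_eq_mul]
  simp only [hev]
  refine ⟨integrable_finsetSum _ hint, ?_⟩
  rw [integral_finsetSum _ hint]
  conv_lhs => rw [eq_ofCoeffs hp, ofCoeffs_apply]
  rw [map_sum]
  refine Finset.sum_congr rfl fun e _ => ?_
  rw [map_smul, riesz_mon, integral_const_mul, (h _ _ (mem_exps.1 e.2)).2, smul_eq_mul]

/-- If `∫ p ^ 2 = 0` then `p` vanishes almost everywhere, and its zero set, being closed, contains
the support. All necessary conditions on the kernel follow from this description. -/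
theorem IsRepresenting.ker_iff (h : IsRepresenting n β μ) {p : Poly} (hp : p.totalDegree ≤ n) :
    Ker n (riesz β) p ↔ ∀ z ∈ μ.support, ev z p = 0 := by
  constructor
  · intro hk
    obtain ⟨hi, he⟩ := h.integral_eq (totalDegree_mul_le_two_mul hp hp)
    rw [hk.2 p hp] at he
    simp only [map_mul] at hi he
    have hae := (integral_eq_zero_iff_of_nonneg (fun z => mul_self_nonneg (ev z p)) hi).1 he.symm
    have hsub : μ.support ⊆ zeroSet p :=
      Measure.support_subset_of_isClosed (isClosed_zeroSet p)
        (hae.mono fun z hz => mul_self_eq_zero.1 hz)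
    exact fun z hz => hsub hz
  · intro hz
    refine ⟨hp, fun q hq => ?_⟩
    rw [(h.integral_eq (totalDegree_mul_le_two_mul hp hq)).2]
    refine integral_eq_zero_of_ae ?_
    filter_upwards [Measure.support_mem_ae (μ := μ)] with z hzs
    rw [map_mul, hz z hzs, zero_mul, Pi.zero_apply]

theorem IsRepresenting.rank_le (h : IsRepresenting n β μ) :
    ((momentMatrix n β).rank : ℕ∞) ≤ μ.support.encard := by
  by_cases hfin : μ.support.Finite
  · obtain ⟨S, hS⟩ := hfin.exists_finset_coe
    rw [← hS, Set.encard_coe_eq_coe_finsetCard, Nat.cast_le]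
    refine rank_le_card fun p hp hz => (h.ker_iff hp).2 fun z hzs => hz z ?_
    rw [← hS] at hzs
    exact hzs
  · rw [Set.Infinite.encard_eq hfin]
    exact le_top

theorem IsRepresenting.support_subset (h : IsRepresenting n β μ) :
    μ.support ⊆ momentVariety n β := fun z hz =>
  mem_momentVariety.2 fun _ hp => (h.ker_iff hp.1).1 hp z hz

theorem IsRepresenting.posSemidef (h : IsRepresenting n β μ) :
    (momentMatrix n β).PosSemidef := by
  rw [posSemidef_iff]
  intro p hp
  rw [pow_two, (h.integral_eq (totalDegree_mul_le_two_mul hp hp)).2]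
  exact integral_nonneg fun z => by
    rw [map_mul]
    exact mul_self_nonneg _

theorem IsRepresenting.recursivelyGenerated (h : IsRepresenting n β μ) :
    RecursivelyGenerated n β := by
  intro p q hp _ hpq hk
  rw [← ker_iff_polyCol n β hpq, h.ker_iff hpq]
  rw [← ker_iff_polyCol n β hp, h.ker_iff hp] at hk
  exact fun z hz => by rw [map_mul, hk z hz, zero_mul]

theorem IsQRepresenting.polyCol_eq_zero {Q : Poly} (h : IsQRepresenting n β Q μ)
    (hQ : Q.totalDegree ≤ n) : polyCol n β Q = 0 := by
  rw [← ker_iff_polyCol n β hQ, h.1.ker_iff hQ]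
  exact fun z hz => h.2 hz

end representing

end HypMoment

/-! ### The main theorem -/

theorem theorem1p1 (n : ℕ) (hn : 2 ≤ n) (Q : HypMoment.Poly) (hQ : HypMoment.IsHyperbola Q)
    (β : ℕ → ℕ → ℝ) (hβ : 0 < β 0 0) :
    ((∃ μ : MeasureTheory.Measure (ℝ × ℝ), HypMoment.IsQRepresenting n β Q μ) ↔
      ((HypMoment.momentMatrix n β).PosSemidef ∧
        HypMoment.RecursivelyGenerated n β ∧
        HypMoment.polyCol n β Q = 0 ∧
        ((HypMoment.momentMatrix n β).rank : ℕ∞) ≤ (HypMoment.momentVariety n β).encard)) ∧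
    ((∃ μ : MeasureTheory.Measure (ℝ × ℝ), HypMoment.IsQRepresenting n β Q μ) →
      (HypMoment.momentMatrix n β).rank ≤ 2 * n + 1 ∧
      ((HypMoment.momentMatrix n β).rank ≤ 2 * n →
        ∃ μ : MeasureTheory.Measure (ℝ × ℝ), HypMoment.IsQRepresenting n β Q μ ∧
          HypMoment.IsAtomicOfCard (HypMoment.momentMatrix n β).rank μ) ∧
      ((HypMoment.momentMatrix n β).rank = 2 * n + 1 →
        ∃ μ : MeasureTheory.Measure (ℝ × ℝ), HypMoment.IsQRepresenting n β Q μ ∧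
          ((2 * n + 1 : ℕ) : ℕ∞) ≤ μ.support.encard ∧
          μ.support.encard ≤ ((2 * n + 2 : ℕ) : ℕ∞))) := by
  have necessary : (∃ μ : MeasureTheory.Measure (ℝ × ℝ), HypMoment.IsQRepresenting n β Q μ) →
      ((HypMoment.momentMatrix n β).PosSemidef ∧
        HypMoment.RecursivelyGenerated n β ∧
        HypMoment.polyCol n β Q = 0 ∧
        ((HypMoment.momentMatrix n β).rank : ℕ∞) ≤ (HypMoment.momentVariety n β).encard) := by
    rintro ⟨μ, hμ⟩
    exact ⟨hμ.1.posSemidef, hμ.1.recursivelyGenerated, hμ.polyCol_eq_zero (hQ.1.le.trans hn),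
      hμ.1.rank_le.trans (Set.encard_le_encard hμ.1.support_subset)⟩
  refine ⟨⟨necessary, fun ⟨h1, h2, h3, h4⟩ => ?_⟩, fun hex => ?_⟩
  · obtain ⟨hle, hsing, hreg⟩ := HypMoment.solvable hn hQ h1 h2 h3 h4
    rcases hle.lt_or_eq with hlt | heq
    · obtain ⟨S, ρ, h, _⟩ := hsing (Nat.lt_succ_iff.1 hlt)
      exact ⟨_, h.isQRepresenting⟩
    · obtain ⟨S, ρ, h, _⟩ := hreg heq
      exact ⟨_, h.isQRepresenting⟩
  · obtain ⟨h1, h2, h3, h4⟩ := necessary hex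
    obtain ⟨hle, hsing, hreg⟩ := HypMoment.solvable hn hQ h1 h2 h3 h4
    refine ⟨hle, fun hr => ?_, fun hr => ?_⟩
    · obtain ⟨S, ρ, h, hS⟩ := hsing hr
      -- Interpolation on the atoms is what makes their number equal to the rank.
      exact ⟨_, h.isQRepresenting, S, ρ, (h.rank_eq hS).symm, h.1, rfl⟩
    · obtain ⟨S, ρ, h, hS⟩ := hreg hr
      -- The lower bound holds for every representing measure, the support having at least rank many
      -- points.
      refine ⟨_, h.isQRepresenting, hr ▸ h.isQRepresenting.1.rank_le, ?_⟩
      refine (Set.encard_le_encard (HypMoment.support_atomic_subset S ρ)).trans ?_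
      rw [Set.encard_coe_eq_coe_finsetCard]
      exact_mod_cast hS
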